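/- Let $K$ be a field with $\operatorname{char} K\neq 2$ and let $r\ge 1$ be a real number. A (unital) Jordan superalgebra over $K$ is a unital, not necessarily associative, $K$-algebra $J$ with a grading $J=J_{\bar 0}\oplus J_{\bar 1}$ by $\mathbb Z/2$ such that for all homogeneous $a,b,c,d$ (of parities $|a|,|b|,|c|,|d|$) one has $ab=(-1)^{|a||b|}ba$ and $$(ab)(cd)+(-1)^{|b||c|}(ac)(bd)+(-1)^{(|b|+|c|)|d|}(ad)(bc)=((ab)c)d+(-1)^{|b|(|c|+|d|)+|c||d|}((ad)c)b+(-1)^{|a|(|b|+|c|+|d|)+|c||d|}((bd)c)a .$$ For a finite set $Y$ generating $J$ as a unital algebra, let $\gamma_J(Y,n)$ be the dimension of the span of all (arbitrarily bracketed) monomials in $Y$ of length at most $n$, where $1$ is the monomial of length $0$, and put $$\operatorname{GKdim}J=\limsup_{n\to\infty}\frac{\ln\gamma_J(Y,n)}{\ln n},\qquad \underline{\operatorname{GKdim}}\,J=\liminf_{n\to\infty}\frac{\ln\gamma_J(Y,n)}{\ln n}.$$ Then there exist a Jordan superalgebra $J$ over $K$ and a set $X\subset J_{\bar 0}\cup J_{\bar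 1}$ of three elements generating $J$ as a unital algebra such that: 1. $\operatorname{GKdim}J=\underline{\operatorname{GKdim}}\,J=r$ (for every choice of the finite generating set $Y$); 2. $J$ is graded by degree in the generators: if $J_n$ denotes the span of all monomials in $X$ of length exactly $n$, then $J=\bigoplus_{n\ge 0}J_n$ and $J_mJ_n\subseteq J_{m+n}$; moreover $J_{3n}=0$ for all $n\ge 1$; 3. the subspace $J^{o}=\bigoplus_{n\ge 1}J_n$ is a two-sided ideal with $J=K1\oplus J^{o}$, and it is solvable of length $3$: writing $S^2$ for the span of all products of two elements of $S$, one has $(((J^{o})^2)^2)^2=0$ while $((J^{o})^2)^2\neq 0$. In particular, taking $1<r<2$, there is no analogue of Bergman's gap $(1,2)$ for Jordan superalgebras. -/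

import Mathlib

universe u v w

section Gradings

variable (K : Type u) {J : Type v} [Field K] [NonAssocRing J] [Module K J]

/-- A grading of a unital, not necessarily associative, `K`-algebra `J` by an additive monoid `ι`:
`J` is the direct sum of the subspaces `𝒜 i`, the unit has degree `0`,
and `𝒜 i * 𝒜 j ⊆ 𝒜 (i + j)`. -/
structure IsAlgebraGrading {ι : Type w} [DecidableEq ι] [AddMonoid ι]
    (𝒜 : ι → Submodule K J) : Prop where
  isInternal : DirectSum.IsInternal 𝒜
  one_mem : (1 : J) ∈ 𝒜 0
  mul_mem : ∀ {i j : ι} {a b : J}, a ∈ 𝒜 i → b ∈ 𝒜 j → a * b ∈ 𝒜 (i + j)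

/-- The sign `(-1) ^ e` in `K`, for a parity `e`. -/
def paritySign (e : ZMod 2) : K := (-1) ^ e.val

/-- `J`, with even part `P 0` and odd part `P 1`, is a (unital) Jordan superalgebra over `K`. -/
structure IsJordanSuperalgebra (P : ZMod 2 → Submodule K J) : Prop where
  isGrading : IsAlgebraGrading K P
  supercomm : ∀ (i j : ZMod 2) (a b : J), a ∈ P i → b ∈ P j →
    a * b = paritySign K (i * j) • (b * a)
  jordan : ∀ (i j k l : ZMod 2) (a b c d : J), a ∈ P i → b ∈ P j → c ∈ P k → d ∈ P l →
    (a * b) * (c * d) + paritySign K (j * k) • ((a * c) * (b * d))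
        + paritySign K ((j + k) * l) • ((a * d) * (b * c))
      = ((a * b) * c) * d + paritySign K (j * (k + l) + k * l) • (((a * d) * c) * b)
        + paritySign K (i * (j + k + l) + k * l) • (((b * d) * c) * a)

end Gradings

section Growth

/-- `IsMonomialOfLength X n a`: the element `a` is a product, with some bracketing, of `n` factors
from `X`; the only monomial of length `0` is the unit. -/
inductive IsMonomialOfLength {J : Type v} [NonAssocRing J] (X : Set J) : ℕ → J → Prop
  | one : IsMonomialOfLength X 0 1
  | gen {x : J} : x ∈ X → IsMonomialOfLength X 1 x
  | mul {m n : ℕ} {a b : J} : IsMonomialOfLength X m a → IsMonomialOfLength X n b →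
      IsMonomialOfLength X (m + n) (a * b)

variable (K : Type u) {J : Type v} [Field K] [NonAssocRing J] [Module K J]

/-- `X` generates `J` as a unital `K`-algebra: the only subspace of `J` which contains `1` and `X`
and is closed under multiplication is `J` itself. -/
def GeneratesAlgebra (X : Set J) : Prop :=
  ∀ S : Submodule K J, (1 : J) ∈ S → X ⊆ S → (∀ a ∈ S, ∀ b ∈ S, a * b ∈ S) → S = ⊤

/-- The span of the monomials in `X` of length exactly `n`. -/
def degreeComponent (X : Set J) (n : ℕ) : Submodule K J :=
  Submodule.span K {a | IsMonomialOfLength X n a}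

/-- The span of the monomials in `X` of length at most `n`. -/
def lengthFiltration (X : Set J) (n : ℕ) : Submodule K J :=
  Submodule.span K {a | ∃ m ≤ n, IsMonomialOfLength X m a}

/-- The growth function of `J` with respect to the (finite) set `X`. -/
noncomputable def growthFunction (X : Set J) (n : ℕ) : ℕ :=
  Module.finrank K (lengthFiltration K X n)

/-- The upper Gelfand-Kirillov dimension, `limsup (ln γ(n) / ln n)`, computed from the finite
generating set `X`. -/
noncomputable def upperGKDim (X : Set J) : EReal :=
  Filter.limsup (fun n : ℕ =>
    ((Real.log (growthFunction K X n : ℝ) / Real.log (n : ℝ) : ℝ) : EReal)) Filter.atTop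

/-- The lower Gelfand-Kirillov dimension, `liminf (ln γ(n) / ln n)`, computed from the finite
generating set `X`. -/
noncomputable def lowerGKDim (X : Set J) : EReal :=
  Filter.liminf (fun n : ℕ =>
    ((Real.log (growthFunction K X n : ℝ) / Real.log (n : ℝ) : ℝ) : EReal)) Filter.atTop

/-- The span of the monomials in `X` of positive length, that is, `⊕_{n ≥ 1} J_n` when `J` is
graded by degree in `X`. -/
def positivePart (X : Set J) : Submodule K J :=
  ⨆ n : ℕ, degreeComponent K X (n + 1)

end Growth

section Solvable

variable {K : Type u} {J : Type v} [Field K] [NonAssocRing J] [Module K J]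

/-- A two-sided ideal of `J`. -/
def IsTwoSidedIdealSubmodule (I : Submodule K J) : Prop :=
  ∀ a : J, ∀ b ∈ I, a * b ∈ I ∧ b * a ∈ I

/-- The derived series `S, S², (S²)², …` of a subalgebra `S`, where `T²` is the span of all
products of two elements of `T`. -/
def derivedPower (S : Submodule K J) : ℕ → Submodule K J
  | 0 => S
  | n + 1 => Submodule.span K {c | ∃ a ∈ derivedPower S n, ∃ b ∈ derivedPower S n, c = a * b}

/-- `S` is solvable of length (exactly) `l`. -/
def IsSolvableOfLength (S : Submodule K J) (l : ℕ) : Prop :=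
  derivedPower S l = ⊥ ∧ ∀ m < l, derivedPower S m ≠ ⊥

end Solvable

set_option linter.unusedSectionVars false

/-! For a Lie algebra `L`, put `J = K1 + K1̄ + L + L̄`, where the only nonzero products, up to sign
and besides those with `1`, are `l·1̄ = l̄` and `l̄·m̄ = [l,m]`. The super Jordan identity for `J`
comes down to the Jacobi identity. If `L` is generated by `x, y`, then `J` is generated by `1̄, x,
y`, because `[l,m] = (l·1̄)(m·1̄)`. A Lie monomial with `h` brackets thus has degree `3h+1` in `J`,
and its barred copy has degree `3h+2`: positive multiples of 3 do not occur. Up to bounded factors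
`J` grows like `L`, and multiplying repeatedly sends `K1̄+L+L̄` into `L+L̄`, then `L`, then `0`.

It remains to find a two-generated graded Lie algebra of growth `n^r`. Take `L = Kx + E`, where `E`
is a free `K[D]`-module on the finite subsets of `ι`, `x` acts as `D`, and `y = ∅`. The elements
`D^j y` act by commuting operators `T j` with `[D, T i] = T (i+1)`; on a subset, `T (s u)` adjoins
`u`, killing sets that contain `u`, and the other `T i` vanish on subsets. A set then has height `∑
(s u + 1)`. If `s` grows like powers of `2^(1/α)`, with `α = r-1`, there are about `n^α` sets of
height at most `n`, and the powers of `D` contribute one more factor `n`.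

Generation needs care (`mk_insertVec_mem`): modulo what is already generated, `[y, D^n y]` equals
`((-1)^n - 1) T n ∅`. This recovers `T n ∅` exactly when `n` is odd and 2 is invertible; hence all
`s u` are odd and `char K ≠ 2`. -/

/-! ### The Jordan double of a Lie algebra -/

/-- The Jordan double `K1 ⊕ K1̄ ⊕ L ⊕ L̄` of a Lie algebra `L`: the Kantor double of the Poisson
algebra `K1 ⊕ L` in which `L * L = 0`. -/
def JordanDouble (K : Type u) (L : Type v) : Type (max u v) := K × K × L × L

namespace JordanDouble

variable {K : Type u} {L : Type v} [Field K] [LieRing L] [LieAlgebra K L]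

instance : AddCommGroup (JordanDouble K L) := inferInstanceAs (AddCommGroup (K × K × L × L))
instance : Module K (JordanDouble K L) := inferInstanceAs (Module K (K × K × L × L))

/-- The element `a1 + b1̄ + l + m̄`. -/
def mk (a b : K) (l m : L) : JordanDouble K L := (a, b, l, m)

lemma mk_surjective (p : JordanDouble K L) : ∃ a b l m, p = mk a b l m :=
  ⟨p.1, p.2.1, p.2.2.1, p.2.2.2, rfl⟩

lemma mk_inj {a b a' b' : K} {l m l' m' : L} :
    mk a b l m = mk a' b' l' m' ↔ a = a' ∧ b = b' ∧ l = l' ∧ m = m' := by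
  change ((a, b, l, m) : K × K × L × L) = (a', b', l', m') ↔ _
  simp

lemma mk_add (a b a' b' : K) (l m l' m' : L) :
    mk a b l m + mk a' b' l' m' = mk (a + a') (b + b') (l + l') (m + m') := rfl

lemma smul_mk (c a b : K) (l m : L) : c • mk a b l m = mk (c * a) (c * b) (c • l) (c • m) := rfl

lemma zero_eq_mk : (0 : JordanDouble K L) = mk 0 0 0 0 := rfl

lemma neg_mk (a b : K) (l m : L) : -mk a b l m = mk (-a) (-b) (-l) (-m) := rfl

instance : Mul (JordanDouble K L) where
  mul p q := mk (p.1 * q.1) (p.1 * q.2.1 + q.1 * p.2.1)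
    (p.1 • q.2.2.1 + q.1 • p.2.2.1 + ⁅p.2.2.2, q.2.2.2⁆)
    (p.1 • q.2.2.2 + q.1 • p.2.2.2 + p.2.1 • q.2.2.1 + q.2.1 • p.2.2.1)

lemma mk_mul (a b a' b' : K) (l m l' m' : L) :
    mk a b l m * mk a' b' l' m' = mk (a * a') (a * b' + a' * b) (a • l' + a' • l + ⁅m, m'⁆)
      (a • m' + a' • m + b • l' + b' • l) := rfl

instance : One (JordanDouble K L) := ⟨mk 1 0 0 0⟩

lemma one_eq_mk : (1 : JordanDouble K L) = mk 1 0 0 0 := rfl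

instance : NonAssocRing (JordanDouble K L) :=
  { (inferInstance : AddCommGroup (JordanDouble K L)),
    (inferInstance : Mul (JordanDouble K L)), (inferInstance : One (JordanDouble K L)) with
    left_distrib := by
      intro p q s
      obtain ⟨a, b, l, m, rfl⟩ := mk_surjective p
      obtain ⟨a', b', l', m', rfl⟩ := mk_surjective q
      obtain ⟨a'', b'', l'', m'', rfl⟩ := mk_surjective s
      simp only [mk_add, mk_mul, mk_inj, lie_add]
      refine ⟨by ring, by ring, by module, by module⟩
    right_distrib := by
      intro p q s
      obtain ⟨a, b, l, m, rfl⟩ := mk_surjective p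
      obtain ⟨a', b', l', m', rfl⟩ := mk_surjective q
      obtain ⟨a'', b'', l'', m'', rfl⟩ := mk_surjective s
      simp only [mk_add, mk_mul, mk_inj, add_lie]
      refine ⟨by ring, by ring, by module, by module⟩
    zero_mul := by
      intro p
      obtain ⟨a, b, l, m, rfl⟩ := mk_surjective p
      simp [zero_eq_mk, mk_mul]
    mul_zero := by
      intro p
      obtain ⟨a, b, l, m, rfl⟩ := mk_surjective p
      simp [zero_eq_mk, mk_mul]
    one_mul := by
      intro p
      obtain ⟨a, b, l, m, rfl⟩ := mk_surjective p
      simp [one_eq_mk, mk_mul]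
    mul_one := by
      intro p
      obtain ⟨a, b, l, m, rfl⟩ := mk_surjective p
      simp [one_eq_mk, mk_mul] }

instance : IsScalarTower K (JordanDouble K L) (JordanDouble K L) where
  smul_assoc := by
    intro c p q
    obtain ⟨a, b, l, m, rfl⟩ := mk_surjective p
    obtain ⟨a', b', l', m', rfl⟩ := mk_surjective q
    simp only [smul_eq_mul, smul_mk, mk_mul, mk_inj, smul_lie]
    refine ⟨by ring, by ring, by module, by module⟩

instance : SMulCommClass K (JordanDouble K L) (JordanDouble K L) where
  smul_comm := by
    intro c p q
    obtain ⟨a, b, l, m, rfl⟩ := mk_surjective p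
    obtain ⟨a', b', l', m', rfl⟩ := mk_surjective q
    simp only [smul_eq_mul, smul_mk, mk_mul, mk_inj, lie_smul]
    refine ⟨by ring, by ring, by module, by module⟩

variable (K L) in
/-- The even part `K1 ⊕ L` and the odd part `K1̄ ⊕ L̄`. -/
def parityPart (i : ZMod 2) : Submodule K (JordanDouble K L) where
  carrier := {p | ∃ (a : K) (l : L), p = if i = 0 then mk a 0 l 0 else mk 0 a 0 l}
  zero_mem' := ⟨0, 0, by split_ifs <;> rfl⟩
  add_mem' := by
    rintro _ _ ⟨a, l, rfl⟩ ⟨a', l', rfl⟩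
    exact ⟨a + a', l + l', by split_ifs <;> simp [mk_add]⟩
  smul_mem' := by
    rintro c _ ⟨a, l, rfl⟩
    exact ⟨c * a, c • l, by split_ifs <;> simp [smul_mk]⟩

lemma mem_parityPart_zero {p : JordanDouble K L} :
    p ∈ parityPart K L 0 ↔ ∃ (a : K) (l : L), p = mk a 0 l 0 := Iff.rfl

lemma mem_parityPart_one {p : JordanDouble K L} :
    p ∈ parityPart K L 1 ↔ ∃ (a : K) (l : L), p = mk 0 a 0 l := Iff.rfl

lemma forall_zmod_two {p : ZMod 2 → Prop} : (∀ i, p i) ↔ p 0 ∧ p 1 := by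
  refine ⟨fun h => ⟨h 0, h 1⟩, fun h i => ?_⟩
  fin_cases i
  exacts [h.1, h.2]

lemma parityPart_isInternal : DirectSum.IsInternal (parityPart K L) := by
  rw [DirectSum.isInternal_submodule_iff_isCompl (i := 0) (j := 1) _ (by decide)
    (Set.eq_univ_iff_forall.2 (forall_zmod_two.2 ⟨by simp, by simp⟩)).symm]
  constructor
  · rw [Submodule.disjoint_def]
    intro p h0 h1
    obtain ⟨a, l, rfl⟩ := mem_parityPart_zero.1 h0
    obtain ⟨a', l', h⟩ := mem_parityPart_one.1 h1
    rw [mk_inj] at h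
    rw [h.1, h.2.2.1]
    rfl
  · rw [codisjoint_iff, eq_top_iff]
    intro p _
    obtain ⟨a, b, l, m, rfl⟩ := mk_surjective p
    exact Submodule.mem_sup.2 ⟨mk a 0 l 0, ⟨a, l, rfl⟩, mk 0 b 0 m, ⟨b, m, rfl⟩,
      by simp [mk_add]⟩

lemma parityPart_isAlgebraGrading : IsAlgebraGrading K (parityPart K L) where
  isInternal := parityPart_isInternal
  one_mem := ⟨1, 0, rfl⟩
  mul_mem := by
    intro i j a b
    revert i j a b
    have h2 : (1 + 1 : ZMod 2) = 0 := by decide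
    simp only [forall_zmod_two, add_zero, zero_add, h2, mem_parityPart_zero, mem_parityPart_one]
    refine ⟨⟨?_, ?_⟩, ?_, ?_⟩
    · rintro _ _ ⟨a, l, rfl⟩ ⟨a', l', rfl⟩
      exact ⟨a * a', a • l' + a' • l, by simp [mk_mul]⟩
    · rintro _ _ ⟨a, l, rfl⟩ ⟨a', l', rfl⟩
      exact ⟨a * a', a • l' + a' • l, by simp [mk_mul]⟩
    · rintro _ _ ⟨a, l, rfl⟩ ⟨a', l', rfl⟩
      exact ⟨a' * a, a' • l + a • l', by simp [mk_mul]⟩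
    · rintro _ _ ⟨a, l, rfl⟩ ⟨a', l', rfl⟩
      exact ⟨0, ⁅l, l'⁆, by simp [mk_mul]⟩

lemma paritySign_zero : paritySign K 0 = 1 := by simp [paritySign]

lemma paritySign_one : paritySign K 1 = -1 := by simp [paritySign, ZMod.val_one]

/-- Since `L·L = L·L̄ = 0`, almost all terms of the Jordan identity cancel by skew-symmetry. The
exception is three arguments in `L̄` and the third argument `1̄`, where the identity is Jacobi. -/
lemma isJordanSuperalgebra : IsJordanSuperalgebra K (parityPart K L) where
  isGrading := parityPart_isAlgebraGrading
  supercomm := by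
    simp only [forall_zmod_two, mem_parityPart_zero, mem_parityPart_one]
    refine ⟨⟨?_, ?_⟩, ?_, ?_⟩ <;>
    · rintro _ _ ⟨a, l, rfl⟩ ⟨a', l', rfl⟩
      simp only [mul_zero, mul_one, paritySign_zero, paritySign_one, mk_mul, neg_mk, smul_zero,
        zero_smul, zero_lie, lie_zero, add_zero, one_smul, neg_smul, lie_skew, mul_comm,
        add_comm, neg_zero]
  jordan := by
    have h2 : (1 + 1 : ZMod 2) = 0 := by decide
    simp only [forall_zmod_two, mem_parityPart_zero, mem_parityPart_one]
    refine ⟨⟨⟨⟨?_, ?_⟩, ?_, ?_⟩, ⟨?_, ?_⟩, ?_, ?_⟩, ⟨⟨?_, ?_⟩, ?_, ?_⟩, ⟨?_, ?_⟩, ?_, ?_⟩ <;>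
    · rintro _ _ _ _ ⟨a, l, rfl⟩ ⟨a', l', rfl⟩ ⟨a'', l'', rfl⟩ ⟨a₃, l₃, rfl⟩
      -- Jacobi, oriented as a rewrite rule; the six skew-symmetry rules below put all brackets in a
      -- fixed order so that the remaining goals are linear.
      have hj : ⁅⁅l, l'⁆, l₃⁆ = ⁅⁅l, l₃⁆, l'⁆ - ⁅⁅l', l₃⁆, l⁆ := by
        rw [lie_lie l l' l₃, ← lie_skew l ⁅l', l₃⁆, ← lie_skew l' ⁅l, l₃⁆]; abel
      have c1 : ⁅l', l⁆ = -⁅l, l'⁆ := (lie_skew _ _).symm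
      have c2 : ⁅l'', l⁆ = -⁅l, l''⁆ := (lie_skew _ _).symm
      have c3 : ⁅l₃, l⁆ = -⁅l, l₃⁆ := (lie_skew _ _).symm
      have c4 : ⁅l'', l'⁆ = -⁅l', l''⁆ := (lie_skew _ _).symm
      have c5 : ⁅l₃, l'⁆ = -⁅l', l₃⁆ := (lie_skew _ _).symm
      have c6 : ⁅l₃, l''⁆ = -⁅l'', l₃⁆ := (lie_skew _ _).symm
      simp only [mul_zero, zero_mul, mul_one, add_zero, zero_add, h2, paritySign_zero,
        paritySign_one, mk_mul, mk_add, neg_mk, smul_zero, zero_smul, zero_lie, lie_zero, one_smul,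
        neg_smul, neg_zero, mk_inj, lie_add, add_lie, lie_smul, smul_lie, hj, c1, c2, c3, c4, c5,
        c6]
      refine ⟨?_, ?_, ?_, ?_⟩ <;> first | trivial | ring1 | module

end JordanDouble

/-! ### The differential module and its commuting operators -/

section DifferentialModule

variable (K : Type u) [Field K] {ι : Type v} [DecidableEq ι]

/-- The free `K[D]`-module with basis the finite subsets of `ι`; `Finsupp.single (j, a) 1` stands
for `D ^ j a`. -/
abbrev SubsetModule (K : Type u) [Field K] (ι : Type v) : Type (max u v) := (ℕ × Finset ι) →₀ K

/-- The basis vector `D ^ j a`. -/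
noncomputable def basisVec (j : ℕ) (a : Finset ι) : SubsetModule K ι := Finsupp.single (j, a) 1

variable {K} in
lemma SubsetModule.hom_ext {M : Type*} [AddCommMonoid M] [Module K M]
    {f g : SubsetModule K ι →ₗ[K] M} (h : ∀ j a, f (basisVec K j a) = g (basisVec K j a)) :
    f = g := by
  refine Finsupp.lhom_ext' fun p => LinearMap.ext_ring ?_
  exact h p.1 p.2

/-- The action of `D`. -/
noncomputable def shift (K : Type u) [Field K] (ι : Type v) :
    SubsetModule K ι →ₗ[K] SubsetModule K ι :=
  Finsupp.lmapDomain K K (Prod.map Nat.succ id)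

omit [DecidableEq ι] in
lemma shift_basisVec (j : ℕ) (a : Finset ι) :
    shift K ι (basisVec K j a) = basisVec K (j + 1) a := by
  simp [shift, basisVec, Finsupp.mapDomain_single]

variable (e : ℕ → Option ι)

/-- Adjoin to `a` the element of `ι` labelled by `i`; this is `0` if there is no such element, or if
it lies in `a` already. -/
noncomputable def insertVec (i : ℕ) (a : Finset ι) : SubsetModule K ι :=
  (e i).elim 0 fun x => if x ∈ a then 0 else basisVec K 0 (insert x a)

/-- The value of the `i`-th operator `T i` at `D ^ j a`; it is determined by
`T i (D v) = D (T i v) - T (i + 1) v` and its values at `j = 0`. -/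
noncomputable def opValue : ℕ → ℕ → Finset ι → SubsetModule K ι
  | 0, i, a => insertVec K e i a
  | j + 1, i, a => shift K ι (opValue j i a) - opValue j (i + 1) a

/-- The operators `T i`. -/
noncomputable def op (i : ℕ) : SubsetModule K ι →ₗ[K] SubsetModule K ι :=
  Finsupp.linearCombination K fun p : ℕ × Finset ι => opValue K e p.1 i p.2

lemma op_basisVec (i j : ℕ) (a : Finset ι) :
    op K e i (basisVec K j a) = opValue K e j i a := by
  simp [op, basisVec]

lemma op_shift (i : ℕ) (v : SubsetModule K ι) :
    op K e i (shift K ι v) = shift K ι (op K e i v) - op K e (i + 1) v := by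
  have : op K e i ∘ₗ shift K ι = shift K ι ∘ₗ op K e i - op K e (i + 1) :=
    SubsetModule.hom_ext fun j a => by
      simp [shift_basisVec, op_basisVec, opValue]
  exact LinearMap.congr_fun this v

/-- Adjoining two elements does not depend on the order; both sides vanish if a label is unused, an
element is already present, or the two coincide. -/
lemma op_insertVec (i i' : ℕ) (a : Finset ι) :
    op K e i (insertVec K e i' a) = op K e i' (insertVec K e i a) := by
  unfold insertVec
  rcases h : e i with _ | x <;> rcases h' : e i' with _ | y
  · simp
  · simp only [Option.elim_some, Option.elim_none, map_zero]
    split_ifs <;> simp [op_basisVec, opValue, insertVec, h]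
  · simp only [Option.elim_some, Option.elim_none, map_zero]
    split_ifs <;> simp [op_basisVec, opValue, insertVec, h']
  · simp only [Option.elim_some]
    by_cases hx : x ∈ a <;> by_cases hy : y ∈ a <;> by_cases hxy : x = y <;>
      simp_all [op_basisVec, opValue, insertVec, Finset.insert_comm, eq_comm]

/-- The commutator rule `[D, T i] = T (i+1)` propagates commutation from subsets to all `D ^ j a`;
each step in `j` raises an index, so all pairs of indices are treated at once. -/
lemma op_comm (i i' : ℕ) (v : SubsetModule K ι) :
    op K e i (op K e i' v) = op K e i' (op K e i v) := by
  have key : ∀ (j : ℕ) (i i' : ℕ) (a : Finset ι),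
      op K e i (opValue K e j i' a) = op K e i' (opValue K e j i a) := by
    intro j
    induction j with
    | zero => exact op_insertVec K e
    | succ j ih =>
      intro i i' a
      simp only [opValue, map_sub, op_shift]
      rw [ih i i' a, ih (i + 1) i' a, ih i (i' + 1) a]
      abel
  have : op K e i ∘ₗ op K e i' = op K e i' ∘ₗ op K e i :=
    SubsetModule.hom_ext fun j a => by simpa [op_basisVec] using key j i i' a
  exact LinearMap.congr_fun this v

/-- The bilinear product in which `D ^ j ∅` acts as `T j`, and `D ^ j a` acts as zero for
nonempty `a`. -/
noncomputable def leftMul : SubsetModule K ι →ₗ[K] SubsetModule K ι →ₗ[K] SubsetModule K ι :=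
  Finsupp.linearCombination K fun p : ℕ × Finset ι => if p.2 = ∅ then op K e p.1 else 0

lemma leftMul_basisVec_empty (j : ℕ) : leftMul K e (basisVec K j ∅) = op K e j := by
  simp [leftMul, basisVec]

lemma leftMul_basisVec_of_ne (j : ℕ) {a : Finset ι} (ha : a ≠ ∅) :
    leftMul K e (basisVec K j a) = 0 := by
  simp [leftMul, basisVec, ha]

/-- `D` is a derivation of the product: this is `[D, T j] = T (j+1)` read through `D ^ j ∅ ↦ T j`,
and it makes `ad x` a derivation of the bracket. -/
lemma shift_leftMul (v w : SubsetModule K ι) :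
    shift K ι (leftMul K e v w) = leftMul K e (shift K ι v) w + leftMul K e v (shift K ι w) := by
  have : (leftMul K e).compr₂ (shift K ι) =
      leftMul K e ∘ₗ shift K ι + (leftMul K e).compl₂ (shift K ι) := by
    apply SubsetModule.hom_ext
    intro j a
    apply LinearMap.ext
    intro w
    by_cases ha : a = ∅
    · subst ha
      simp [shift_basisVec, leftMul_basisVec_empty, op_shift]
    · simp [shift_basisVec, leftMul_basisVec_of_ne K e _ ha]
  exact LinearMap.congr_fun (LinearMap.congr_fun this v) w

/-- At `j = 0` the value is zero or a nonempty set, which acts as zero. Vanishing passes to `D v`,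
since `(D v) w = D (v w) - v (D w)`. -/
lemma leftMul_opValue (i j : ℕ) (a : Finset ι) : leftMul K e (opValue K e j i a) = 0 := by
  induction j generalizing i with
  | zero =>
    unfold opValue insertVec
    rcases e i with _ | x
    · simp
    · simp only [Option.elim_some]
      split_ifs
      · simp
      · exact leftMul_basisVec_of_ne K e _ (Finset.insert_ne_empty _ _)
  | succ j ih =>
    refine LinearMap.ext fun w => ?_
    have h := shift_leftMul K e (opValue K e j i a) w
    rw [ih] at h
    simp only [LinearMap.zero_apply, map_zero, add_zero] at h
    simp [opValue, ih, ← h]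

lemma leftMul_leftMul (v w : SubsetModule K ι) : leftMul K e (leftMul K e v w) = 0 := by
  have : (leftMul K e).compr₂ (leftMul K e) = 0 := by
    apply SubsetModule.hom_ext
    intro j a
    apply SubsetModule.hom_ext
    intro j' a'
    by_cases ha : a = ∅
    · subst ha
      simp [leftMul_basisVec_empty, op_basisVec, leftMul_opValue]
    · simp [leftMul_basisVec_of_ne K e _ ha]
  exact LinearMap.congr_fun (LinearMap.congr_fun this v) w

/-- Together with `(v w) x = 0`, this left-commutativity makes the commutator of the product a Lie
bracket. -/
lemma leftMul_comm (v w x : SubsetModule K ι) :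
    leftMul K e v (leftMul K e w x) = leftMul K e w (leftMul K e v x) := by
  suffices h : ∀ x, (leftMul K e).compl₂ ((leftMul K e).flip x) =
      ((leftMul K e).compl₂ ((leftMul K e).flip x)).flip from
    LinearMap.congr_fun (LinearMap.congr_fun (h x) v) w
  intro x
  apply SubsetModule.hom_ext
  intro j a
  apply SubsetModule.hom_ext
  intro j' a'
  by_cases ha : a = ∅ <;> by_cases ha' : a' = ∅
  · subst ha ha'
    simp [leftMul_basisVec_empty, op_comm K e j j']
  all_goals simp_all [leftMul_basisVec_of_ne]

end DifferentialModule

/-! ### The Lie algebra `K x ⊕ E` -/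

/-- The Lie algebra `K x ⊕ E`, where `E` is the subset module with the commutator bracket of
`leftMul`, and `x` acts on `E` by the derivation `D`. -/
def ShiftLie (K : Type u) [Field K] {ι : Type v} (_e : ℕ → Option ι) : Type (max u v) :=
  K × SubsetModule K ι

namespace ShiftLie

variable {K : Type u} [Field K] {ι : Type v} [DecidableEq ι] {e : ℕ → Option ι}

noncomputable instance : AddCommGroup (ShiftLie K e) :=
  inferInstanceAs (AddCommGroup (K × SubsetModule K ι))
noncomputable instance : Module K (ShiftLie K e) :=
  inferInstanceAs (Module K (K × SubsetModule K ι))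

/-- The element `c x + v`. -/
def mk (e : ℕ → Option ι) (c : K) (v : SubsetModule K ι) : ShiftLie K e := (c, v)

lemma mk_surjective (p : ShiftLie K e) : ∃ c v, p = mk e c v := ⟨p.1, p.2, rfl⟩

lemma mk_inj {c c' : K} {v v' : SubsetModule K ι} : mk e c v = mk e c' v' ↔ c = c' ∧ v = v' := by
  change ((c, v) : K × SubsetModule K ι) = (c', v') ↔ _
  simp

lemma mk_add (c c' : K) (v v' : SubsetModule K ι) :
    mk e c v + mk e c' v' = mk e (c + c') (v + v') := rfl

lemma smul_mk (k c : K) (v : SubsetModule K ι) : k • mk e c v = mk e (k * c) (k • v) := rfl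

lemma mk_sub (c c' : K) (v v' : SubsetModule K ι) :
    mk e c v - mk e c' v' = mk e (c - c') (v - v') := rfl

lemma zero_eq_mk : (0 : ShiftLie K e) = mk e 0 0 := rfl

noncomputable instance : Bracket (ShiftLie K e) (ShiftLie K e) where
  bracket p q := mk e 0 (p.1 • shift K ι q.2 - q.1 • shift K ι p.2
    + (leftMul K e p.2 q.2 - leftMul K e q.2 p.2))

lemma mk_lie (c c' : K) (v v' : SubsetModule K ι) :
    ⁅mk e c v, mk e c' v'⁆ = mk e 0 (c • shift K ι v' - c' • shift K ι v
      + (leftMul K e v v' - leftMul K e v' v)) := rfl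

noncomputable instance : LieRing (ShiftLie K e) where
  add_lie p q s := by
    obtain ⟨a, l, rfl⟩ := mk_surjective p
    obtain ⟨b, m, rfl⟩ := mk_surjective q
    obtain ⟨c, n, rfl⟩ := mk_surjective s
    simp only [mk_add, mk_lie, mk_inj, map_add, LinearMap.add_apply, add_zero, true_and]
    module
  lie_add p q s := by
    obtain ⟨a, l, rfl⟩ := mk_surjective p
    obtain ⟨b, m, rfl⟩ := mk_surjective q
    obtain ⟨c, n, rfl⟩ := mk_surjective s
    simp only [mk_add, mk_lie, mk_inj, map_add, LinearMap.add_apply, add_zero, true_and]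
    module
  lie_self p := by
    obtain ⟨a, l, rfl⟩ := mk_surjective p
    simp [mk_lie, zero_eq_mk]
  leibniz_lie p q s := by
    obtain ⟨a, l, rfl⟩ := mk_surjective p
    obtain ⟨b, m, rfl⟩ := mk_surjective q
    obtain ⟨c, n, rfl⟩ := mk_surjective s
    simp only [mk_add, mk_lie, mk_inj, map_add, map_sub, map_smul, LinearMap.add_apply,
      LinearMap.sub_apply, LinearMap.smul_apply, add_zero, true_and, zero_smul, shift_leftMul,
      leftMul_leftMul, LinearMap.zero_apply]
    -- With `(v w) u = 0` and the Leibniz rule already applied, only triple products `u (v w)` and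
    -- terms containing `D` remain; the former cancel in pairs by left-commutativity.
    rw [leftMul_comm K e l m n, leftMul_comm K e l n m, leftMul_comm K e m n l]
    module

noncomputable instance : LieAlgebra K (ShiftLie K e) where
  lie_smul k p q := by
    obtain ⟨a, l, rfl⟩ := mk_surjective p
    obtain ⟨b, m, rfl⟩ := mk_surjective q
    simp only [smul_mk, mk_lie, mk_inj, map_smul, LinearMap.smul_apply, mul_zero, true_and]
    module

end ShiftLie

/-! ### Homogeneous bases and heights -/

/-- A basis `b` of a Lie algebra `L` which is homogeneous for a grading of `L` with the two
generators `b x` and `b y` in degree one; the degree of `b i` is `ht i + 1`. -/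
structure IsHomogeneousLieBasis {K : Type u} {L : Type v} {I : Type w} [Field K] [LieRing L]
    [LieAlgebra K L] (b : Module.Basis I K L) (ht : I → ℕ) (x y : I) : Prop where
  ht_fst : ht x = 0
  ht_snd : ht y = 0
  lie_mem : ∀ i j, ⁅b i, b j⁆ ∈ Submodule.span K (b '' {k | ht k = ht i + ht j + 1})
  generates : ∀ F : ℕ → Submodule K L, b x ∈ F 0 → b y ∈ F 0 →
    (∀ m n l l', l ∈ F m → l' ∈ F n → ⁅l, l'⁆ ∈ F (m + n + 1)) → ∀ i, b i ∈ F (ht i)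

section Heights

variable {K : Type u} [Field K] {ι : Type v} [DecidableEq ι] (s : ι → ℕ)

/-- The weight of a finite subset of `ι`. -/
def weight (a : Finset ι) : ℕ := ∑ i ∈ a, (s i + 1)

variable (K) in
/-- The span of the basis vectors `D ^ j a` of height `n`. -/
noncomputable def heightPart (n : ℕ) : Submodule K (SubsetModule K ι) :=
  Submodule.span K ((fun p : ℕ × Finset ι => basisVec K p.1 p.2) '' {p | p.1 + weight s p.2 = n})

omit [DecidableEq ι] in
lemma basisVec_mem_heightPart {n j : ℕ} {a : Finset ι} (h : j + weight s a = n) :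
    basisVec K j a ∈ heightPart K s n :=
  Submodule.subset_span ⟨(j, a), h, rfl⟩

omit [DecidableEq ι] in
lemma shift_mem_heightPart {n : ℕ} {v : SubsetModule K ι} (hv : v ∈ heightPart K s n) :
    shift K ι v ∈ heightPart K s (n + 1) := by
  suffices h : heightPart K s n ≤ (heightPart K s (n + 1)).comap (shift K ι) from h hv
  refine Submodule.span_le.2 ?_
  rintro _ ⟨⟨j, a⟩, h, rfl⟩
  simp only [Set.mem_ofPred_eq] at h
  simp only [Submodule.comap_coe, Set.mem_preimage, shift_basisVec, SetLike.mem_coe]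
  exact basisVec_mem_heightPart (K := K) s (by omega)

variable {s} {e : ℕ → Option ι} (hs : Function.IsPartialInv s e)

include hs in
-- The `+ 1` in `weight` is the bracket spent on adjoining an element: `D ^ (s u) ∅` has height `s
-- u`, and bracketing adds one.
lemma insertVec_mem_heightPart (i : ℕ) (a : Finset ι) :
    insertVec K e i a ∈ heightPart K s (i + weight s a + 1) := by
  unfold insertVec
  rcases h : e i with _ | x
  · simp
  · simp only [Option.elim_some]
    split_ifs with hx
    · simp
    · refine basisVec_mem_heightPart s ?_
      rw [weight, Finset.sum_insert hx, (hs x i).1 h, weight]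
      omega

include hs in
lemma opValue_mem_heightPart (j i : ℕ) (a : Finset ι) :
    opValue K e j i a ∈ heightPart K s (j + i + weight s a + 1) := by
  induction j generalizing i with
  | zero => simpa [opValue] using insertVec_mem_heightPart hs i a
  | succ j ih =>
    refine Submodule.sub_mem _ ?_ ?_
    · have h := shift_mem_heightPart s (ih i)
      convert h using 2
      omega
    · convert ih (i + 1) using 2
      omega

include hs in
lemma leftMul_mem_heightPart (j j' : ℕ) (a a' : Finset ι) :
    leftMul K e (basisVec K j a) (basisVec K j' a') ∈
      heightPart K s ((j + weight s a) + (j' + weight s a') + 1) := by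
  by_cases ha : a = ∅
  · subst ha
    rw [leftMul_basisVec_empty, op_basisVec]
    convert opValue_mem_heightPart hs j' j a' using 2
    simp [weight]
    omega
  · simp [leftMul_basisVec_of_ne K e _ ha]

end Heights

/-! ### Generation of the Lie algebra by two elements -/

namespace ShiftLie

variable {K : Type u} [Field K] {ι : Type v} [DecidableEq ι] (e : ℕ → Option ι)

/-- The embedding of the subset module as an ideal of codimension one. -/
noncomputable def incl : SubsetModule K ι →ₗ[K] ShiftLie K e := LinearMap.inr K K _

/-- The basis of the Lie algebra which consists of `x` and of the vectors `D ^ j a`. -/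
noncomputable def basis : Module.Basis (Unit ⊕ (ℕ × Finset ι)) K (ShiftLie K e) :=
  (Module.Basis.singleton Unit K).prod (Finsupp.basisSingleOne (R := K) (ι := ℕ × Finset ι))

omit [DecidableEq ι] in
lemma basis_inl (t : Unit) : basis (K := K) e (Sum.inl t) = mk e 1 0 := by
  change ((Module.Basis.singleton Unit K).prod Finsupp.basisSingleOne) (Sum.inl t) = _
  refine Prod.ext ?_ ?_
  · simp [mk]
  · simp [mk]

omit [DecidableEq ι] in
lemma basis_inr (p : ℕ × Finset ι) : basis (K := K) e (Sum.inr p) = mk e 0 (basisVec K p.1 p.2) := by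
  change ((Module.Basis.singleton Unit K).prod Finsupp.basisSingleOne) (Sum.inr p) = _
  refine Prod.ext ?_ ?_
  · simp [mk]
  · simp [mk, basisVec]

/-- The heights of the basis vectors. -/
def height (s : ι → ℕ) : Unit ⊕ (ℕ × Finset ι) → ℕ
  | Sum.inl _ => 0
  | Sum.inr p => p.1 + weight s p.2

variable {e} {s : ι → ℕ}

omit [DecidableEq ι] in
lemma mk_mem_span_basis {n : ℕ} {v : SubsetModule K ι} (hv : v ∈ heightPart K s n) :
    mk e 0 v ∈ Submodule.span K (basis (K := K) e '' {k | height s k = n}) := by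
  suffices h : heightPart K s n ≤
      (Submodule.span K (basis (K := K) e '' {k | height s k = n})).comap (incl e) from h hv
  refine Submodule.span_le.2 ?_
  rintro _ ⟨p, h, rfl⟩
  exact Submodule.subset_span ⟨Sum.inr p, h, basis_inr e p⟩

lemma lie_basis_mem (hs : Function.IsPartialInv s e) (p q : Unit ⊕ (ℕ × Finset ι)) :
    ⁅basis (K := K) e p, basis (K := K) e q⁆ ∈
      Submodule.span K (basis (K := K) e '' {k | height s k = height s p + height s q + 1}) := by
  rcases p with t | ⟨j, a⟩ <;> rcases q with t' | ⟨j', a'⟩ <;>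
    simp only [basis_inl, basis_inr, mk_lie] <;> refine mk_mem_span_basis ?_
  · simp
  · simp only [one_smul, zero_smul, map_zero, LinearMap.zero_apply, sub_zero, add_zero,
      height, zero_add]
    exact shift_mem_heightPart s (basisVec_mem_heightPart s (n := j' + weight s a') rfl)
  · simp only [one_smul, zero_smul, map_zero, LinearMap.zero_apply, sub_zero, add_zero,
      height, zero_sub]
    exact Submodule.neg_mem _ (shift_mem_heightPart s
      (basisVec_mem_heightPart s (n := j + weight s a) rfl))
  · simp only [zero_smul, sub_zero, zero_add]
    refine Submodule.sub_mem _ (leftMul_mem_heightPart hs _ _ _ _) ?_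
    rw [height, height, add_comm (j + _)]
    exact leftMul_mem_heightPart hs _ _ _ _

section Generation

variable {F : ℕ → Submodule K (ShiftLie K e)} (hx : mk e 1 0 ∈ F 0)
  (hF : ∀ m n l l', l ∈ F m → l' ∈ F n → ⁅l, l'⁆ ∈ F (m + n + 1))

include hx hF in
lemma mk_shift_mem {n : ℕ} {v : SubsetModule K ι} (hv : mk e 0 v ∈ F n) :
    mk e 0 (shift K ι v) ∈ F (n + 1) := by
  simpa [mk_lie] using hF 0 n _ _ hx hv

include hx hF in
lemma mk_basisVec_add_mem {n j : ℕ} {a : Finset ι} (hv : mk e 0 (basisVec K j a) ∈ F n) (k : ℕ) :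
    mk e 0 (basisVec K (j + k) a) ∈ F (n + k) := by
  induction k with
  | zero => exact hv
  | succ k ih =>
    rw [← add_assoc, ← add_assoc, ← shift_basisVec]
    exact mk_shift_mem hx hF ih

include hx hF in
-- Commuting `T i` past `D ^ j` gives `T i D ^ j ∅ ≡ (-1)^j T (i+j) ∅`, modulo positive powers of
-- `D` applied to `T k ∅` with `k < i + j`.
lemma mk_opValue_sub_mem {n : ℕ} (hn : ∀ k < n, mk e 0 (insertVec K e k ∅) ∈ F (k + 1))
    (j i : ℕ) (hij : i + j = n) :
    mk e 0 (opValue K e j i ∅ - (-1 : K) ^ j • insertVec K e n ∅) ∈ F (n + 1) := by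
  have key : ∀ n, (∀ k < n, mk e 0 (insertVec K e k ∅) ∈ F (k + 1)) → ∀ i, i + j = n →
      mk e 0 (opValue K e j i ∅ - (-1 : K) ^ j • insertVec K e n ∅) ∈ F (n + 1) := by
    clear hij hn i n
    induction j with
    | zero =>
      rintro n - i rfl
      simp [opValue, ← zero_eq_mk]
    | succ j ih =>
      rintro n hn i rfl
      have h1 := ih (i + j) (fun k hk => hn k (by omega)) i rfl
      -- The correction term has index `i + j` below the current bound, so it is already available
      -- and `T i D ^ j ∅` itself may be shifted.
      have h2 := Submodule.add_mem _ h1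
        (Submodule.smul_mem _ ((-1 : K) ^ j) (hn (i + j) (by omega)))
      rw [smul_mk, mk_add, mul_zero, add_zero, sub_add_cancel] at h2
      have h3 := mk_shift_mem hx hF h2
      have h4 := ih (i + (j + 1)) hn (i + 1) (by omega)
      have h5 := Submodule.sub_mem _ h3 h4
      rw [mk_sub, sub_self] at h5
      have h6 : opValue K e (j + 1) i ∅ - (-1 : K) ^ (j + 1) • insertVec K e (i + (j + 1)) ∅ =
          shift K ι (opValue K e j i ∅) - (opValue K e j (i + 1) ∅ -
            (-1 : K) ^ j • insertVec K e (i + (j + 1)) ∅) := by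
        rw [pow_succ]
        simp only [opValue]
        module
      rw [h6]
      exact h5
  exact key n hn i hij

include hx hF in
-- For even `n` the vector is zero, as labels are odd. For odd `n`, `[y, D ^ n y] = T 0 D ^ n ∅ - T
-- n ∅ ≡ -2 T n ∅`, and 2 is inverted.
lemma mk_insertVec_mem (hy : mk e 0 (basisVec K 0 ∅) ∈ F 0) (h2 : (2 : K) ≠ 0)
    (hs : Function.IsPartialInv s e) (hodd : ∀ i, Odd (s i)) (n : ℕ) :
    mk e 0 (insertVec K e n ∅) ∈ F (n + 1) := by
  induction n using Nat.strong_induction_on with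
  | _ n ih =>
    rcases Nat.even_or_odd n with hn | hn
    · rcases h : e n with _ | x
      · simp [insertVec, h, ← zero_eq_mk]
      · exact absurd hn (Nat.not_even_iff_odd.2 ((hs x n).1 h ▸ hodd x))
    · have h1 := mk_opValue_sub_mem hx hF ih n 0 (by omega)
      have hy' : mk e 0 (basisVec K n ∅) ∈ F n := by
        simpa using mk_basisVec_add_mem hx hF hy n
      have h3 := hF 0 n _ _ hy hy'
      rw [mk_lie] at h3
      simp only [zero_smul, sub_zero, zero_add, leftMul_basisVec_empty, op_basisVec] at h3
      have h4 := Submodule.smul_mem _ (2⁻¹ : K) (Submodule.sub_mem _ h1 h3)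
      rw [mk_sub, smul_mk, sub_zero, mul_zero] at h4
      convert h4 using 2
      have h5 : opValue K e n 0 ∅ - (-1 : K) ^ n • insertVec K e n ∅ -
          (opValue K e n 0 ∅ - opValue K e 0 n ∅) = (2 : K) • insertVec K e n ∅ := by
        rw [hn.neg_one_pow]
        simp only [opValue]
        module
      rw [h5, smul_smul, inv_mul_cancel₀ h2, one_smul]

include hx hF in
-- Singletons come from the previous lemma. A nonempty `a` acts as zero, so bracketing `D ^ (s u) ∅`
-- with it adjoins `u` without correction terms.
lemma mk_basisVec_mem (hy : mk e 0 (basisVec K 0 ∅) ∈ F 0) (h2 : (2 : K) ≠ 0)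
    (hs : Function.IsPartialInv s e) (hodd : ∀ i, Odd (s i)) (j : ℕ) (a : Finset ι) :
    mk e 0 (basisVec K j a) ∈ F (j + weight s a) := by
  suffices h : mk e 0 (basisVec K 0 a) ∈ F (weight s a) by
    simpa [add_comm] using mk_basisVec_add_mem hx hF h j
  induction a using Finset.induction_on with
  | empty => simpa [weight] using hy
  | insert u a hu ih =>
    have heu : e (s u) = some u := (hs u _).2 rfl
    have hw : weight s (insert u a) = s u + weight s a + 1 := by
      rw [weight, Finset.sum_insert hu, weight]
      omega
    rw [hw]
    by_cases ha : a = ∅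
    · subst ha
      have h := mk_insertVec_mem hx hF hy h2 hs hodd (s u)
      simpa [insertVec, heu, weight] using h
    · have hy' : mk e 0 (basisVec K (s u) ∅) ∈ F (s u) := by
        simpa using mk_basisVec_add_mem hx hF hy (s u)
      have h3 := hF _ _ _ _ hy' ih
      rw [mk_lie] at h3
      simpa [leftMul_basisVec_empty, op_basisVec, leftMul_basisVec_of_ne K e _ ha, opValue,
        insertVec, heu, hu] using h3

end Generation

lemma isHomogeneousLieBasis (h2 : (2 : K) ≠ 0) (hs : Function.IsPartialInv s e)
    (hodd : ∀ i, Odd (s i)) :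
    IsHomogeneousLieBasis (basis (K := K) e) (height s) (Sum.inl ()) (Sum.inr (0, ∅)) where
  ht_fst := rfl
  ht_snd := by simp [height, weight]
  lie_mem := lie_basis_mem hs
  generates F hx hy hF := by
    rw [basis_inl] at hx
    rw [basis_inr] at hy
    rintro (t | ⟨j, a⟩)
    · rwa [basis_inl]
    · rw [basis_inr]
      exact mk_basisVec_mem hx hF hy h2 hs hodd j a

lemma lie_basis_ne_zero :
    ⁅basis (K := K) e (Sum.inl ()), basis (K := K) e (Sum.inr (0, ∅))⁆ ≠ 0 := by
  rw [basis_inl, basis_inr, mk_lie, zero_eq_mk, Ne, mk_inj]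
  simp only [one_smul, zero_smul, sub_zero, map_zero, LinearMap.zero_apply, shift_basisVec]
  simp [basisVec]

end ShiftLie

/-! ### Length filtrations and change of generators -/

section Filtration

variable {K : Type u} {J : Type v} [Field K] [NonAssocRing J] [Module K J]

lemma lengthFiltration_mono (X : Set J) {m n : ℕ} (h : m ≤ n) :
    lengthFiltration K X m ≤ lengthFiltration K X n :=
  Submodule.span_mono fun _ ⟨k, hk, ha⟩ => ⟨k, hk.trans h, ha⟩

lemma one_mem_lengthFiltration (X : Set J) (n : ℕ) : (1 : J) ∈ lengthFiltration K X n :=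
  Submodule.subset_span ⟨0, n.zero_le, .one⟩

variable [IsScalarTower K J J] [SMulCommClass K J J]

lemma mul_mem_of_mem_span {s t : Set J} {N : Submodule K J} (h : ∀ a ∈ s, ∀ b ∈ t, a * b ∈ N)
    {a b : J} (ha : a ∈ Submodule.span K s) (hb : b ∈ Submodule.span K t) : a * b ∈ N := by
  induction ha using Submodule.span_induction with
  | mem a ha =>
    induction hb using Submodule.span_induction with
    | mem b hb => exact h a ha b hb
    | zero => simp
    | add x y _ _ hx hy => rw [mul_add]; exact N.add_mem hx hy
    | smul c x _ hx => rw [mul_smul_comm]; exact N.smul_mem c hx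
  | zero => simp
  | add x y _ _ hx hy => rw [add_mul]; exact N.add_mem hx hy
  | smul c x _ hx => rw [smul_mul_assoc]; exact N.smul_mem c hx

lemma mul_mem_lengthFiltration {X : Set J} {m n : ℕ} {a b : J} (ha : a ∈ lengthFiltration K X m)
    (hb : b ∈ lengthFiltration K X n) : a * b ∈ lengthFiltration K X (m + n) := by
  refine mul_mem_of_mem_span ?_ ha hb
  rintro a ⟨k, hk, ha⟩ b ⟨l, hl, hb⟩
  exact Submodule.subset_span ⟨k + l, by omega, ha.mul hb⟩

lemma mul_mem_degreeComponent {X : Set J} {m n : ℕ} {a b : J} (ha : a ∈ degreeComponent K X m)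
    (hb : b ∈ degreeComponent K X n) : a * b ∈ degreeComponent K X (m + n) := by
  refine mul_mem_of_mem_span ?_ ha hb
  exact fun a ha b hb => Submodule.subset_span (ha.mul hb)

/-- The union of the filtration is closed under products and contains `1` and `Y`. -/
lemma exists_mem_lengthFiltration {Y : Set J} (hY : GeneratesAlgebra K Y) (a : J) :
    ∃ n, a ∈ lengthFiltration K Y n := by
  have hmono : Monotone (lengthFiltration K Y) := fun _ _ => lengthFiltration_mono Y
  have htop : (⨆ n, lengthFiltration K Y n) = ⊤ := by
    refine hY _ (Submodule.mem_iSup_of_mem 0 (one_mem_lengthFiltration Y 0)) (fun y hy => ?_) ?_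
    · exact Submodule.mem_iSup_of_mem 1 (Submodule.subset_span ⟨1, le_rfl, .gen hy⟩)
    · intro a ha b hb
      rw [Submodule.mem_iSup_of_directed _ hmono.directed_le] at ha hb
      obtain ⟨m, ha⟩ := ha
      obtain ⟨n, hb⟩ := hb
      exact Submodule.mem_iSup_of_mem (m + n) (mul_mem_lengthFiltration ha hb)
  have ha : a ∈ ⨆ n, lengthFiltration K Y n := htop ▸ Submodule.mem_top
  rwa [Submodule.mem_iSup_of_directed _ hmono.directed_le] at ha

lemma exists_subset_lengthFiltration {Y : Set J} (hY : GeneratesAlgebra K Y) (X : Finset J) :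
    ∃ c, 1 ≤ c ∧ (X : Set J) ⊆ lengthFiltration K Y c := by
  choose f hf using exists_mem_lengthFiltration hY
  refine ⟨X.sup f + 1, by omega, fun x hx => ?_⟩
  exact lengthFiltration_mono Y ((Finset.le_sup hx).trans (Nat.le_succ _)) (hf x)

lemma lengthFiltration_le {X Y : Set J} {c : ℕ} (h : X ⊆ lengthFiltration K Y c) (n : ℕ) :
    lengthFiltration K X n ≤ lengthFiltration K Y (c * n) := by
  have key : ∀ m a, IsMonomialOfLength X m a → a ∈ lengthFiltration K Y (c * m) := by
    intro m a ha
    induction ha with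
    | one => exact one_mem_lengthFiltration Y _
    | gen hx => simpa using h hx
    | mul _ _ ha hb => rw [mul_add]; exact mul_mem_lengthFiltration ha hb
  refine Submodule.span_le.2 ?_
  rintro a ⟨m, hm, ha⟩
  exact lengthFiltration_mono Y (Nat.mul_le_mul_left c hm) (key m a ha)

end Filtration

/-! ### Gelfand-Kirillov dimension from two-sided power bounds -/

section Growth

open Filter Topology

lemma tendsto_log_div_log {γ : ℕ → ℕ} {r c C : ℝ} (hc : 0 < c) (hC : 0 < C)
    (h : ∀ᶠ n : ℕ in atTop, c * (n : ℝ) ^ r ≤ γ n ∧ (γ n : ℝ) ≤ C * (n : ℝ) ^ r) :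
    Tendsto (fun n : ℕ => Real.log (γ n) / Real.log n) atTop (𝓝 r) := by
  have hlog : Tendsto (fun n : ℕ => Real.log (n : ℝ)) atTop atTop :=
    Real.tendsto_log_atTop.comp tendsto_natCast_atTop_atTop
  have hlim : ∀ k : ℝ, Tendsto (fun n : ℕ => Real.log k / Real.log (n : ℝ) + r) atTop (𝓝 r) := by
    intro k
    simpa using (hlog.const_div_atTop (Real.log k)).add_const r
  have hlogeq : ∀ (k : ℝ), 0 < k → ∀ n : ℕ, 1 < n →
      Real.log (k * (n : ℝ) ^ r) / Real.log n = Real.log k / Real.log n + r := by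
    intro k hk n hn
    have hn' : (0 : ℝ) < n := by positivity
    have : 0 < Real.log n := Real.log_pos (by exact_mod_cast hn)
    rw [Real.log_mul hk.ne' (by positivity), Real.log_rpow hn']
    field_simp
  refine tendsto_of_tendsto_of_tendsto_of_le_of_le' (hlim c) (hlim C) ?_ ?_
  · filter_upwards [h, eventually_gt_atTop 1] with n hn h1
    have hn' : (0 : ℝ) < n := by positivity
    rw [← hlogeq c hc n h1]
    have : 0 ≤ Real.log n := Real.log_natCast_nonneg n
    exact div_le_div_of_nonneg_right (Real.log_le_log (by positivity) hn.1) this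
  · filter_upwards [h, eventually_gt_atTop 1] with n hn h1
    have hn' : (0 : ℝ) < n := by positivity
    rw [← hlogeq C hC n h1]
    have : 0 ≤ Real.log n := Real.log_natCast_nonneg n
    refine div_le_div_of_nonneg_right (Real.log_le_log ?_ hn.2) this
    exact lt_of_lt_of_le (by positivity) hn.1

variable {K : Type u} {J : Type v} [Field K] [NonAssocRing J] [Module K J]
  [IsScalarTower K J J] [SMulCommClass K J J]

/-- Two finite generating sets have growth functions comparable up to a linear rescaling of `n`,
which changes only the constants in the power bounds. -/
lemma gkDim_eq_of_growth_bounds {X Y : Finset J} (hX : GeneratesAlgebra K (X : Set J))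
    (hY : GeneratesAlgebra K (Y : Set J))
    (hfin : ∀ n, FiniteDimensional K (lengthFiltration K (X : Set J) n))
    {r c C : ℝ} (hr : 0 ≤ r) (hc : 0 < c) (hC : 0 < C)
    (h : ∀ᶠ n : ℕ in atTop, c * (n : ℝ) ^ r ≤ growthFunction K (X : Set J) n ∧
      (growthFunction K (X : Set J) n : ℝ) ≤ C * (n : ℝ) ^ r) :
    upperGKDim K (Y : Set J) = r ∧ lowerGKDim K (Y : Set J) = r := by
  obtain ⟨k, hk, hXY⟩ := exists_subset_lengthFiltration hY X
  obtain ⟨l, hl, hYX⟩ := exists_subset_lengthFiltration hX Y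
  have hfinY : ∀ n, FiniteDimensional K (lengthFiltration K (Y : Set J) n) := fun n =>
    Submodule.finiteDimensional_of_le (lengthFiltration_le hYX n)
  have hup : ∀ n, growthFunction K (Y : Set J) n ≤ growthFunction K (X : Set J) (l * n) :=
    fun n => Submodule.finrank_mono (lengthFiltration_le hYX n)
  have hlow : ∀ n, growthFunction K (X : Set J) (n / k) ≤ growthFunction K (Y : Set J) n :=
    fun n => Submodule.finrank_mono ((lengthFiltration_le hXY (n / k)).trans
      (lengthFiltration_mono _ (Nat.mul_div_le n k)))
  have hk' : (0 : ℝ) < k := by exact_mod_cast hk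
  have hl' : (0 : ℝ) < l := by exact_mod_cast hl
  have hbound : ∀ᶠ n : ℕ in atTop,
      (c * (2 * k : ℝ)⁻¹ ^ r) * (n : ℝ) ^ r ≤ growthFunction K (Y : Set J) n ∧
      (growthFunction K (Y : Set J) n : ℝ) ≤ (C * (l : ℝ) ^ r) * (n : ℝ) ^ r := by
    have h1 := (Nat.tendsto_div_const_atTop (by omega : k ≠ 0)).eventually h
    have h2 := (tendsto_id.const_mul_atTop' (by omega : 0 < l)).eventually h
    filter_upwards [h1, h2, eventually_ge_atTop k] with n h1 h2 hn
    constructor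
    · refine le_trans ?_ (h1.1.trans (by exact_mod_cast hlow n))
      rw [mul_assoc, ← Real.mul_rpow (by positivity) (by positivity)]
      refine mul_le_mul_of_nonneg_left (Real.rpow_le_rpow (by positivity) ?_ hr) hc.le
      have h3 : 1 ≤ n / k := (Nat.one_le_div_iff (by omega)).2 hn
      have h4 : n < k * (n / k) + k := by
        have := Nat.div_add_mod n k
        have := Nat.mod_lt n (by omega : k > 0)
        omega
      -- Rounding down in `n / k` loses at most a factor 2 once `n ≥ k`; hence the `2 * k` in the
      -- lower constant.
      have h5 : n ≤ 2 * k * (n / k) := by nlinarith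
      rw [inv_mul_le_iff₀ (by positivity)]
      exact_mod_cast h5
    · refine le_trans (by exact_mod_cast hup n) (h2.2.trans (le_of_eq ?_))
      rw [mul_assoc, ← Real.mul_rpow (by positivity) (by positivity)]
      simp
  have hlim := tendsto_log_div_log (by positivity) (by positivity) hbound
  have hlim' := (continuous_coe_real_ereal.tendsto r).comp hlim
  exact ⟨hlim'.limsup_eq, hlim'.liminf_eq⟩

end Growth

/-! ### Odd sequences with prescribed growth of subset sums -/

/-- If `s i` grows like `lam ^ i`, a set of weight at most `n` uses only about `log n / log lam`
indices, and conversely all subsets of about that many indices qualify. The count is of order `2 ^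
(log n / log lam) = n ^ α` for `lam = 2 ^ (1/α)`. For `α = 0` the index type is empty. -/
lemma exists_odd_sequence_growth {α : ℝ} (hα : 0 ≤ α) :
    ∃ (ι : Type) (s : ι → ℕ), Function.Injective s ∧ (∀ i, Odd (s i)) ∧
      (∀ n, {a : Finset ι | weight s a ≤ n}.Finite) ∧
      ∃ c C : ℝ, 0 < c ∧ 0 < C ∧ ∀ n : ℕ, 1 ≤ n →
        c * (n : ℝ) ^ α ≤ {a : Finset ι | weight s a ≤ n}.ncard ∧
        ({a : Finset ι | weight s a ≤ n}.ncard : ℝ) ≤ C * (n : ℝ) ^ α := by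
  rcases hα.eq_or_lt with rfl | hα
  · refine ⟨Empty, Empty.elim, fun i => i.elim, fun i => i.elim, fun n => Set.toFinite _,
      1, 1, one_pos, one_pos, fun n _ => ?_⟩
    have : {a : Finset Empty | weight Empty.elim a ≤ n} = {∅} := by
      ext a
      simp [Finset.eq_empty_of_isEmpty a, weight]
    simp [this]
  set lam : ℝ := 2 ^ (1 / α) with hlam
  have hlam1 : 1 < lam := Real.one_lt_rpow (by norm_num) (by positivity)
  have hlamα : ∀ k : ℕ, (lam ^ k) ^ α = 2 ^ k := by
    intro k
    rw [hlam, ← Real.rpow_natCast, ← Real.rpow_mul (by positivity), ← Real.rpow_mul (by positivity)]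
    rw [← Real.rpow_natCast]
    congr 1
    field_simp
  -- The summand `i` forces strict monotonicity even where the floors repeat; the outer form `2 * _
  -- + 1` forces oddness.
  set s : ℕ → ℕ := fun i => 2 * (i + ⌊lam ^ i⌋₊) + 1 with hs
  have hmono : StrictMono s := by
    refine strictMono_nat_of_lt_succ fun i => ?_
    have : ⌊lam ^ i⌋₊ ≤ ⌊lam ^ (i + 1)⌋₊ :=
      Nat.floor_mono (pow_le_pow_right₀ hlam1.le (Nat.le_succ i))
    simp only [hs]
    omega
  have hlow : ∀ i, lam ^ i ≤ s i := by
    intro i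
    have h := Nat.lt_floor_add_one (lam ^ i)
    simp only [hs]
    push_cast
    have : (0 : ℝ) ≤ i := by positivity
    have : (0 : ℝ) ≤ (⌊lam ^ i⌋₊ : ℝ) := by positivity
    linarith
  -- `B` must satisfy `B (lam - 1) lam ^ m ≥ s m + 1`. Here `s m + 1 ≤ 2 m + 4 lam ^ m`, and
  -- Bernoulli gives `m ≤ lam ^ m / (lam - 1)`. The extra 1 ensures `B ≥ 1`.
  obtain ⟨B, hB1, hB⟩ : ∃ B : ℝ, 1 ≤ B ∧ ∀ m, (weight s (Finset.range m) : ℝ) ≤ B * lam ^ m := by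
    have hd : 0 < lam - 1 := by linarith
    refine ⟨1 + (2 / (lam - 1) + 4) / (lam - 1), by
      have : 0 ≤ (2 / (lam - 1) + 4) / (lam - 1) := by positivity
      linarith, fun m => ?_⟩
    induction m with
    | zero =>
      simp only [weight, Finset.range_zero, Finset.sum_empty, Nat.cast_zero]
      positivity
    | succ m ih =>
      have h0 : weight s (Finset.range (m + 1)) = weight s (Finset.range m) + (s m + 1) := by
        simp [weight, Finset.sum_range_succ]
      have h1 : 1 + m * (lam - 1) ≤ lam ^ m := by
        simpa using one_add_mul_le_pow (a := lam - 1) (by linarith) m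
      have h2 : (m : ℝ) ≤ lam ^ m / (lam - 1) := by
        rw [le_div_iff₀ hd]
        linarith
      have h3 : (⌊lam ^ m⌋₊ : ℝ) ≤ lam ^ m := Nat.floor_le (by positivity)
      have h4 : 1 ≤ lam ^ m := one_le_pow₀ hlam1.le
      have h5 : (1 + (2 / (lam - 1) + 4) / (lam - 1)) * lam ^ (m + 1) =
          (1 + (2 / (lam - 1) + 4) / (lam - 1)) * lam ^ m + (lam - 1) * lam ^ m
            + (2 * (lam ^ m / (lam - 1)) + 4 * lam ^ m) := by
        field_simp
        ring
      have h6 : 0 ≤ (lam - 1) * lam ^ m := by positivity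
      rw [h0, h5]
      simp only [hs]
      push_cast
      linarith
  have hmem : ∀ (n : ℕ) (a : Finset ℕ), weight s a ≤ n → ∀ i ∈ a, lam ^ i ≤ n := by
    intro n a ha i hi
    refine (hlow i).trans ?_
    have : s i + 1 ≤ weight s a :=
      Finset.single_le_sum (f := fun i => s i + 1) (fun _ _ => Nat.zero_le _) hi
    exact_mod_cast (by omega : s i ≤ n)
  have hsub : ∀ n : ℕ, 1 ≤ n → ∃ m : ℕ, (2 : ℝ) ^ m ≤ 2 * (n : ℝ) ^ α ∧
      {a : Finset ℕ | weight s a ≤ n} ⊆ ((Finset.range m).powerset : Set (Finset ℕ)) := by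
    intro n hn
    obtain ⟨m, hm1, hm2⟩ := exists_nat_pow_near (x := (n : ℝ)) (by exact_mod_cast hn) hlam1
    refine ⟨m + 1, ?_, fun a ha => ?_⟩
    · have := Real.rpow_le_rpow (by positivity) hm1 hα.le
      rw [hlamα] at this
      rw [pow_succ]
      linarith
    · rw [Finset.coe_powerset, Set.mem_preimage, Set.mem_powerset_iff]
      intro i hi
      have h1 := (hmem n a ha i hi).trans_lt hm2
      simpa using (pow_lt_pow_iff_right₀ hlam1).1 h1
  have hfin : ∀ n, {a : Finset ℕ | weight s a ≤ n}.Finite := by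
    intro n
    obtain ⟨m, -, hm⟩ := hsub (n + 1) (by omega)
    exact (Finset.finite_toSet _).subset (Set.Subset.trans (fun a (ha : _ ≤ n) => by
      exact Nat.le_succ_of_le ha) hm)
  refine ⟨ℕ, s, hmono.injective, fun i => ⟨i + ⌊lam ^ i⌋₊, rfl⟩, hfin,
    (2 * B ^ α)⁻¹ , 2, by positivity, by norm_num, fun n hn => ⟨?_, ?_⟩⟩
  · rcases le_or_gt B n with hBn | hBn
    · obtain ⟨m, hm1, hm2⟩ := exists_nat_pow_near (x := (n : ℝ) / B)
        (by rwa [one_le_div (by linarith)]) hlam1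
      have hcard : 2 ^ m ≤ {a : Finset ℕ | weight s a ≤ n}.ncard := by
        have : (((Finset.range m).powerset : Finset (Finset ℕ)) : Set (Finset ℕ)) ⊆
            {a : Finset ℕ | weight s a ≤ n} := by
          intro a ha
          rw [Finset.mem_coe, Finset.mem_powerset] at ha
          have h1 : weight s a ≤ weight s (Finset.range m) := Finset.sum_le_sum_of_subset ha
          have h2 : (weight s (Finset.range m) : ℝ) ≤ n := by
            refine (hB m).trans ?_
            rwa [le_div_iff₀ (by linarith), mul_comm] at hm1
          exact h1.trans (by exact_mod_cast h2)
        have h := Set.ncard_le_ncard this (hfin n)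
        rwa [Set.ncard_coe_finset, Finset.card_powerset, Finset.card_range] at h
      have h1 := Real.rpow_le_rpow (by positivity) hm2.le hα.le
      rw [hlamα, Real.div_rpow (by positivity) (by positivity), pow_succ] at h1
      have h2 : (2 : ℝ) ^ m ≤ {a : Finset ℕ | weight s a ≤ n}.ncard := by exact_mod_cast hcard
      refine le_trans ?_ h2
      rw [mul_inv, mul_assoc, inv_mul_le_iff₀ (by norm_num), inv_mul_eq_div]
      linarith
    -- For `n < B` the empty set alone suffices.
    · have h1 : 1 ≤ {a : Finset ℕ | weight s a ≤ n}.ncard := by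
        rw [Nat.one_le_iff_ne_zero, ← Nat.pos_iff_ne_zero, Set.ncard_pos (hfin n)]
        exact ⟨∅, by simp [weight]⟩
      have h2 : (1 : ℝ) ≤ {a : Finset ℕ | weight s a ≤ n}.ncard := by exact_mod_cast h1
      refine le_trans ?_ h2
      rw [inv_mul_le_iff₀ (by positivity)]
      have := Real.rpow_le_rpow (by positivity) hBn.le hα.le
      have h3 : 0 < B ^ α := by positivity
      linarith
  · obtain ⟨m, hm1, hm2⟩ := hsub n hn
    have h := Set.ncard_le_ncard hm2 (Finset.finite_toSet _)
    rw [Set.ncard_coe_finset, Finset.card_powerset, Finset.card_range] at h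
    exact le_trans (by exact_mod_cast h) hm1

/-! ### Subspaces spanned by parts of a basis -/

section HomogeneousBasis

variable {K : Type u} {V : Type v} {T : Type w} [Field K] [AddCommGroup V] [Module K V]

lemma Module.Basis.isInternal_span_fibers (B : Module.Basis T K V) (d : T → ℕ) :
    DirectSum.IsInternal fun n => Submodule.span K (B '' {t | d t = n}) := by
  refine DirectSum.isInternal_submodule_of_iSupIndep_of_iSup_eq_top (fun n => ?_) ?_
  · have hle : (⨆ (j) (_ : j ≠ n), Submodule.span K (B '' {t | d t = j})) ≤
        Submodule.span K (B '' {t | d t ≠ n}) :=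
      iSup₂_le fun j hj => Submodule.span_mono (Set.image_mono fun t (ht : d t = j) => ht.trans_ne hj)
    refine Disjoint.mono_right hle (B.linearIndependent.disjoint_span_image ?_)
    exact Set.disjoint_left.2 fun t h h' => h' h
  · rw [eq_top_iff, ← B.span_eq, Submodule.span_le]
    rintro _ ⟨t, rfl⟩
    exact Submodule.mem_iSup_of_mem (d t) (Submodule.subset_span ⟨t, rfl, rfl⟩)

lemma Module.Basis.finrank_span_image (B : Module.Basis T K V) (S : Set T) :
    Module.finrank K (Submodule.span K (B '' S)) = S.ncard := by
  have h : LinearIndepOn K id (B '' S) := (B.linearIndependent.linearIndepOn (s := S)).id_image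
  rw [Module.finrank, rank_span_set h, ← Set.ncard_image_of_injective S B.injective]
  rfl

end HomogeneousBasis

/-! ### Grading, generation and solvability of the Jordan double -/

namespace JordanDouble

variable {K : Type u} {L : Type v} {I : Type w} [Field K] [LieRing L] [LieAlgebra K L]

/-- The basis `1, 1̄, b i, (b i)̄` of the Jordan double. -/
noncomputable def basis (b : Module.Basis I K L) :
    Module.Basis (Unit ⊕ Unit ⊕ I ⊕ I) K (JordanDouble K L) :=
  (Module.Basis.singleton Unit K).prod ((Module.Basis.singleton Unit K).prod (b.prod b))

/-- The degrees of the basis vectors of the Jordan double. -/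
def deg (ht : I → ℕ) : Unit ⊕ Unit ⊕ I ⊕ I → ℕ
  | Sum.inl _ => 0
  | Sum.inr (Sum.inl _) => 1
  | Sum.inr (Sum.inr (Sum.inl i)) => 3 * ht i + 1
  | Sum.inr (Sum.inr (Sum.inr i)) => 3 * ht i + 2

section Basis

variable (b : Module.Basis I K L)

lemma basis_one (t : Unit) : basis b (Sum.inl t) = mk 1 0 0 0 := by
  change ((Module.Basis.singleton Unit K).prod
    ((Module.Basis.singleton Unit K).prod (b.prod b))) (Sum.inl t) = _
  simp [Module.Basis.prod_apply, mk, Prod.ext_iff]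

lemma basis_bar (t : Unit) : basis b (Sum.inr (Sum.inl t)) = mk 0 1 0 0 := by
  change ((Module.Basis.singleton Unit K).prod
    ((Module.Basis.singleton Unit K).prod (b.prod b))) (Sum.inr (Sum.inl t)) = _
  simp [Module.Basis.prod_apply, mk, Prod.ext_iff]

lemma basis_even (i : I) : basis b (Sum.inr (Sum.inr (Sum.inl i))) = mk 0 0 (b i) 0 := by
  change ((Module.Basis.singleton Unit K).prod
    ((Module.Basis.singleton Unit K).prod (b.prod b))) (Sum.inr (Sum.inr (Sum.inl i))) = _
  simp [Module.Basis.prod_apply, mk]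

lemma basis_odd (i : I) : basis b (Sum.inr (Sum.inr (Sum.inr i))) = mk 0 0 0 (b i) := by
  change ((Module.Basis.singleton Unit K).prod
    ((Module.Basis.singleton Unit K).prod (b.prod b))) (Sum.inr (Sum.inr (Sum.inr i))) = _
  simp [Module.Basis.prod_apply, mk]

end Basis

open Classical in
/-- The three generators `1̄`, `x`, `y` of the Jordan double. -/
noncomputable def gens (K : Type u) [Field K] [LieAlgebra K L] (x y : L) :
    Finset (JordanDouble K L) :=
  {mk 0 1 0 0, mk 0 0 x 0, mk 0 0 y 0}

lemma mem_gens {x y : L} {p : JordanDouble K L} :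
    p ∈ (gens K x y : Set (JordanDouble K L)) ↔
      p = mk 0 1 0 0 ∨ p = mk 0 0 x 0 ∨ p = mk 0 0 y 0 := by
  simp [gens]

lemma gens_card {x y : L} (hxy : x ≠ y) : (gens K x y).card = 3 := by
  classical
  refine Finset.card_eq_three.2 ⟨_, _, _, ?_, ?_, ?_, by unfold gens; congr⟩ <;> simp [mk_inj, hxy]

lemma gens_homogeneous {x y : L} {p : JordanDouble K L} (hp : p ∈ gens K x y) :
    ∃ i, p ∈ parityPart K L i := by
  rcases mem_gens.1 hp with rfl | rfl | rfl
  exacts [⟨1, 1, 0, rfl⟩, ⟨0, 0, x, rfl⟩, ⟨0, 0, y, rfl⟩]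

/-- The coefficient of `1`. -/
noncomputable def unitCoeff (K : Type u) (L : Type v) [Field K] [LieRing L] [LieAlgebra K L] :
    JordanDouble K L →ₗ[K] K :=
  LinearMap.fst K K (K × L × L)

section Graded

variable {b : Module.Basis I K L} {ht : I → ℕ} {x y : I} (hb : IsHomogeneousLieBasis b ht x y)

/-- The inclusion of `L` as a subspace of the even part. -/
noncomputable def evenIncl (K : Type u) (L : Type v) [Field K] [LieRing L] [LieAlgebra K L] :
    L →ₗ[K] JordanDouble K L :=
  LinearMap.inr K K (K × L × L) ∘ₗ LinearMap.inr K K (L × L) ∘ₗ LinearMap.inl K L L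

/-- The inclusion of `L̄` as a subspace of the odd part. -/
noncomputable def oddIncl (K : Type u) (L : Type v) [Field K] [LieRing L] [LieAlgebra K L] :
    L →ₗ[K] JordanDouble K L :=
  LinearMap.inr K K (K × L × L) ∘ₗ LinearMap.inr K K (L × L) ∘ₗ LinearMap.inr K L L

lemma evenIncl_apply (l : L) : evenIncl K L l = mk 0 0 l 0 := rfl

lemma oddIncl_apply (l : L) : oddIncl K L l = mk 0 0 0 l := rfl

variable (b ht) in
/-- The span of the basis vectors of degree `n`. -/
noncomputable def homogeneousPart (n : ℕ) : Submodule K (JordanDouble K L) :=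
  Submodule.span K (basis b '' {t | deg ht t = n})

lemma basis_mem_homogeneousPart {n : ℕ} (t : Unit ⊕ Unit ⊕ I ⊕ I) (h : deg ht t = n) :
    basis b t ∈ homogeneousPart b ht n :=
  Submodule.subset_span ⟨t, h, rfl⟩

include hb in
-- Two arithmetic facts: `1̄` takes degree `3h+1` to `3h+2`, and `(3h+2) + (3h'+2) = 3(h+h'+1) + 1`
-- matches the height of a bracket.
lemma basis_mul_basis_mem (t t' : Unit ⊕ Unit ⊕ I ⊕ I) :
    basis b t * basis b t' ∈ homogeneousPart b ht (deg ht t + deg ht t') := by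
  have hone : (1 : JordanDouble K L) = basis b (Sum.inl ()) := (basis_one b ()).symm
  have hz : ∀ {p : JordanDouble K L} {n}, p = 0 → p ∈ homogeneousPart b ht n := by
    rintro p n rfl
    exact Submodule.zero_mem _
  rcases t with t | t | i | i
  · rw [basis_one, ← one_eq_mk, one_mul]
    exact basis_mem_homogeneousPart t' (by simp [deg])
  · rcases t' with t' | t' | j | j
    · rw [basis_one, ← one_eq_mk, mul_one]
      exact basis_mem_homogeneousPart _ (by simp [deg])
    · exact hz (by simp [basis_bar, mk_mul, zero_eq_mk])
    · have : basis b (Sum.inr (Sum.inl t)) * basis b (Sum.inr (Sum.inr (Sum.inl j))) =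
          basis b (Sum.inr (Sum.inr (Sum.inr j))) := by
        simp [basis_bar, basis_even, basis_odd, mk_mul]
      rw [this]
      exact basis_mem_homogeneousPart _ (by simp only [deg]; omega)
    · exact hz (by simp [basis_bar, basis_odd, mk_mul, zero_eq_mk])
  · rcases t' with t' | t' | j | j
    · rw [basis_one, ← one_eq_mk, mul_one]
      exact basis_mem_homogeneousPart _ (by simp [deg])
    · have : basis b (Sum.inr (Sum.inr (Sum.inl i))) * basis b (Sum.inr (Sum.inl t')) =
          basis b (Sum.inr (Sum.inr (Sum.inr i))) := by
        simp [basis_bar, basis_even, basis_odd, mk_mul]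
      rw [this]
      exact basis_mem_homogeneousPart _ (by simp only [deg])
    · exact hz (by simp [basis_even, mk_mul, zero_eq_mk])
    · exact hz (by simp [basis_even, basis_odd, mk_mul, zero_eq_mk])
  · rcases t' with t' | t' | j | j
    · rw [basis_one, ← one_eq_mk, mul_one]
      exact basis_mem_homogeneousPart _ (by simp [deg])
    · exact hz (by simp [basis_bar, basis_odd, mk_mul, zero_eq_mk])
    · exact hz (by simp [basis_even, basis_odd, mk_mul, zero_eq_mk])
    · have : basis b (Sum.inr (Sum.inr (Sum.inr i))) * basis b (Sum.inr (Sum.inr (Sum.inr j))) =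
          evenIncl K L ⁅b i, b j⁆ := by
        simp [basis_odd, mk_mul, evenIncl_apply]
      rw [this]
      have hle : Submodule.span K (b '' {k | ht k = ht i + ht j + 1}) ≤
          (homogeneousPart b ht (3 * ht i + 2 + (3 * ht j + 2))).comap (evenIncl K L) := by
        refine Submodule.span_le.2 ?_
        rintro _ ⟨k, hk, rfl⟩
        have h := basis_even b k
        rw [← evenIncl_apply] at h
        simp only [Submodule.comap_coe, Set.mem_preimage, ← h]
        simp only [Set.mem_ofPred_eq] at hk
        exact basis_mem_homogeneousPart _ (by simp only [deg]; omega)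
      exact hle (hb.lie_mem i j)

include hb in
lemma degreeComponent_le_homogeneousPart (n : ℕ) :
    degreeComponent K (gens K (b x) (b y) : Set (JordanDouble K L)) n ≤ homogeneousPart b ht n := by
  refine Submodule.span_le.2 fun p hp => ?_
  simp only [Set.mem_ofPred_eq] at hp
  induction hp with
  | one =>
    rw [one_eq_mk, ← basis_one b ()]
    exact basis_mem_homogeneousPart _ rfl
  | gen hp =>
    rcases mem_gens.1 hp with rfl | rfl | rfl
    · rw [← basis_bar b ()]
      exact basis_mem_homogeneousPart _ rfl
    · rw [← basis_even b x]
      exact basis_mem_homogeneousPart _ (by simp [deg, hb.ht_fst])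
    · rw [← basis_even b y]
      exact basis_mem_homogeneousPart _ (by simp [deg, hb.ht_snd])
  | @mul m n _ _ _ _ h h' =>
    refine mul_mem_of_mem_span ?_ h h'
    rintro _ ⟨t, rfl, rfl⟩ _ ⟨t', rfl, rfl⟩
    exact basis_mul_basis_mem hb t t'

lemma bar_mem_degreeComponent (l l' : L) :
    mk 0 1 0 0 ∈ degreeComponent K (gens K l l' : Set (JordanDouble K L)) 1 :=
  Submodule.subset_span (.gen (mem_gens.2 (Or.inl rfl)))

lemma odd_mem_degreeComponent {l₀ l₁ l : L} {n : ℕ}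
    (h : mk 0 0 l 0 ∈ degreeComponent K (gens K l₀ l₁ : Set (JordanDouble K L)) n) :
    mk 0 0 0 l ∈ degreeComponent K (gens K l₀ l₁ : Set (JordanDouble K L)) (n + 1) := by
  simpa [mk_mul] using mul_mem_degreeComponent h (bar_mem_degreeComponent l₀ l₁)

include hb in
-- Since `[l,l'] = (l·1̄)(l'·1̄)`, the elements of `L` lying in degrees `3n+1` form a family closed
-- under brackets as `generates` requires.
lemma even_mem_degreeComponent (i : I) :
    mk 0 0 (b i) 0 ∈
      degreeComponent K (gens K (b x) (b y) : Set (JordanDouble K L)) (3 * ht i + 1) := by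
  refine hb.generates (fun n => (degreeComponent K (gens K (b x) (b y) : Set (JordanDouble K L))
    (3 * n + 1)).comap (evenIncl K L)) ?_ ?_ ?_ i
  · exact Submodule.subset_span (.gen (mem_gens.2 (Or.inr (Or.inl rfl))))
  · exact Submodule.subset_span (.gen (mem_gens.2 (Or.inr (Or.inr rfl))))
  · intro m n l l' hl hl'
    have h := mul_mem_degreeComponent (odd_mem_degreeComponent hl) (odd_mem_degreeComponent hl')
    rw [Submodule.mem_comap, evenIncl_apply]
    convert h using 2
    · omega
    · simp [mk_mul]

include hb in
lemma basis_mem_degreeComponent (t : Unit ⊕ Unit ⊕ I ⊕ I) :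
    basis b t ∈ degreeComponent K (gens K (b x) (b y) : Set (JordanDouble K L)) (deg ht t) := by
  rcases t with t | t | i | i
  · rw [basis_one, ← one_eq_mk]
    exact Submodule.subset_span .one
  · rw [basis_bar]
    exact bar_mem_degreeComponent _ _
  · rw [basis_even]
    exact even_mem_degreeComponent hb i
  · rw [basis_odd]
    exact odd_mem_degreeComponent (even_mem_degreeComponent hb i)

include hb in
lemma degreeComponent_eq (n : ℕ) :
    degreeComponent K (gens K (b x) (b y) : Set (JordanDouble K L)) n = homogeneousPart b ht n := by
  refine le_antisymm (degreeComponent_le_homogeneousPart hb n) (Submodule.span_le.2 ?_)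
  rintro _ ⟨t, rfl, rfl⟩
  exact basis_mem_degreeComponent hb t

include hb in
lemma lengthFiltration_eq (n : ℕ) :
    lengthFiltration K (gens K (b x) (b y) : Set (JordanDouble K L)) n =
      Submodule.span K (basis b '' {t | deg ht t ≤ n}) := by
  refine le_antisymm (Submodule.span_le.2 ?_) (Submodule.span_le.2 ?_)
  · rintro p ⟨m, hm, hp⟩
    have h := degreeComponent_le_homogeneousPart hb m (Submodule.subset_span hp)
    exact Submodule.span_mono (Set.image_mono fun t (ht' : deg ht t = m) => ht'.trans_le hm) h
  · rintro _ ⟨t, h, rfl⟩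
    have hle : degreeComponent K (gens K (b x) (b y) : Set (JordanDouble K L)) (deg ht t) ≤
        lengthFiltration K (gens K (b x) (b y) : Set (JordanDouble K L)) n :=
      Submodule.span_mono fun p hp => ⟨deg ht t, h, hp⟩
    exact hle (basis_mem_degreeComponent hb t)

include hb in
lemma gens_generatesAlgebra :
    GeneratesAlgebra K (gens K (b x) (b y) : Set (JordanDouble K L)) := by
  intro S h1 hX hmul
  have key : ∀ n p, IsMonomialOfLength (gens K (b x) (b y) : Set (JordanDouble K L)) n p →
      p ∈ S := by
    intro n p hp
    induction hp with
    | one => exact h1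
    | gen hx => exact hX hx
    | mul _ _ ha hb => exact hmul _ ha _ hb
  rw [eq_top_iff, ← (basis b).span_eq, Submodule.span_le]
  rintro _ ⟨t, rfl⟩
  exact Submodule.span_le.2 (fun p hp => key _ p hp) (basis_mem_degreeComponent hb t)

include hb in
lemma degreeComponent_isAlgebraGrading :
    IsAlgebraGrading K (degreeComponent K (gens K (b x) (b y) : Set (JordanDouble K L))) where
  isInternal := by
    rw [funext (degreeComponent_eq hb)]
    exact (basis b).isInternal_span_fibers (deg ht)
  one_mem := Submodule.subset_span .one
  mul_mem := mul_mem_degreeComponent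

include hb in
lemma degreeComponent_three_mul {n : ℕ} (hn : 1 ≤ n) :
    degreeComponent K (gens K (b x) (b y) : Set (JordanDouble K L)) (3 * n) = ⊥ := by
  rw [degreeComponent_eq hb, homogeneousPart, Submodule.span_eq_bot]
  rintro _ ⟨t, h, rfl⟩
  rcases t with t | t | i | i <;> simp only [Set.mem_ofPred_eq, deg] at h <;> omega

include hb in
-- Identifies the positive part with the kernel of the coefficient of `1`; its ideal property and
-- solvability can then be read off in coordinates.
lemma mem_positivePart {p : JordanDouble K L} :
    p ∈ positivePart K (gens K (b x) (b y) : Set (JordanDouble K L)) ↔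
      ∃ (c : K) (l m : L), p = mk 0 c l m := by
  constructor
  · intro hp
    have hle : positivePart K (gens K (b x) (b y) : Set (JordanDouble K L)) ≤
        LinearMap.ker (unitCoeff K L) := by
      refine iSup_le fun n => ?_
      rw [degreeComponent_eq hb]
      refine Submodule.span_le.2 ?_
      rintro _ ⟨t, h, rfl⟩
      rw [SetLike.mem_coe, LinearMap.mem_ker]
      rcases t with t | t | i | i
      · simp [deg] at h
      · rw [basis_bar]; rfl
      · rw [basis_even]; rfl
      · rw [basis_odd]; rfl
    have h := hle hp
    obtain ⟨a, c, l, m, rfl⟩ := mk_surjective p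
    obtain rfl : a = 0 := h
    exact ⟨c, l, m, rfl⟩
  · rintro ⟨c, l, m, rfl⟩
    set N := positivePart K (gens K (b x) (b y) : Set (JordanDouble K L)) with hN
    have hmem : ∀ t, 0 < deg ht t → basis b t ∈ N := by
      intro t h
      obtain ⟨n, hn⟩ := Nat.exists_eq_add_of_lt h
      refine Submodule.mem_iSup_of_mem n ?_
      rw [show n + 1 = deg ht t by omega]
      exact basis_mem_degreeComponent hb t
    have h1 : ∀ l, evenIncl K L l ∈ N := by
      have : (⊤ : Submodule K L) ≤ N.comap (evenIncl K L) := by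
        rw [← b.span_eq, Submodule.span_le]
        rintro _ ⟨i, rfl⟩
        have := hmem (Sum.inr (Sum.inr (Sum.inl i))) (by simp [deg])
        rwa [basis_even] at this
      exact fun l => this Submodule.mem_top
    have h2 : ∀ l, oddIncl K L l ∈ N := by
      have : (⊤ : Submodule K L) ≤ N.comap (oddIncl K L) := by
        rw [← b.span_eq, Submodule.span_le]
        rintro _ ⟨i, rfl⟩
        have := hmem (Sum.inr (Sum.inr (Sum.inr i))) (by simp [deg])
        rwa [basis_odd] at this
      exact fun l => this Submodule.mem_top
    have h3 := hmem (Sum.inr (Sum.inl ())) (by simp [deg])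
    rw [basis_bar] at h3
    have h4 := N.add_mem (N.add_mem (N.smul_mem c h3) (h1 l)) (h2 m)
    simpa [evenIncl_apply, oddIncl_apply, mk_add, smul_mk] using h4

include hb in
lemma positivePart_isTwoSidedIdeal :
    IsTwoSidedIdealSubmodule (positivePart K (gens K (b x) (b y) : Set (JordanDouble K L))) := by
  intro p q hq
  rw [mem_positivePart hb] at hq
  obtain ⟨c, l, m, rfl⟩ := hq
  obtain ⟨a', c', l', m', rfl⟩ := mk_surjective p
  rw [mem_positivePart hb, mem_positivePart hb, mk_mul, mk_mul]
  simp only [mul_zero, zero_mul, mk_inj, true_and]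
  exact ⟨⟨_, _, _, rfl, rfl, rfl⟩, ⟨_, _, _, rfl, rfl, rfl⟩⟩

include hb in
lemma isCompl_positivePart :
    IsCompl (Submodule.span K {(1 : JordanDouble K L)})
      (positivePart K (gens K (b x) (b y) : Set (JordanDouble K L))) := by
  constructor
  · rw [Submodule.disjoint_def]
    intro p hp hp'
    obtain ⟨a, rfl⟩ := Submodule.mem_span_singleton.1 hp
    obtain ⟨c, l, m, h⟩ := (mem_positivePart hb).1 hp'
    rw [one_eq_mk, smul_mk, mk_inj, mul_one] at h
    rw [h.1, zero_smul]
  · rw [codisjoint_iff, eq_top_iff]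
    intro p _
    obtain ⟨a, c, l, m, rfl⟩ := mk_surjective p
    refine Submodule.mem_sup.2 ⟨a • 1, Submodule.smul_mem _ a (Submodule.mem_span_singleton_self 1),
      mk 0 c l m, (mem_positivePart hb).2 ⟨c, l, m, rfl⟩, ?_⟩
    simp [one_eq_mk, smul_mk, mk_add]

include hb in
-- The derived series lies in `L + L̄`, then `L`, then `0`, as `L·L = 0`. It is nonzero at step 2
-- because `l̄ = 1̄·l` lies in the square, hence `[x,y] = x̄·ȳ` in the next term.
lemma positivePart_isSolvableOfLength (hxy : ⁅b x, b y⁆ ≠ 0) :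
    IsSolvableOfLength (positivePart K (gens K (b x) (b y) : Set (JordanDouble K L))) 3 := by
  set N := positivePart K (gens K (b x) (b y) : Set (JordanDouble K L)) with hN
  have h1 : derivedPower N 1 ≤
      LinearMap.range (evenIncl K L) ⊔ LinearMap.range (oddIncl K L) := by
    refine Submodule.span_le.2 ?_
    rintro _ ⟨p, hp, q, hq, rfl⟩
    obtain ⟨c, l, m, rfl⟩ := (mem_positivePart hb).1 hp
    obtain ⟨c', l', m', rfl⟩ := (mem_positivePart hb).1 hq
    refine Submodule.mem_sup.2 ⟨_, ⟨⁅m, m'⁆, rfl⟩, _, ⟨c • l' + c' • l, rfl⟩, ?_⟩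
    simp [evenIncl_apply, oddIncl_apply, mk_add, mk_mul]
  have h2 : derivedPower N 2 ≤ LinearMap.range (evenIncl K L) := by
    refine Submodule.span_le.2 ?_
    rintro _ ⟨p, hp, q, hq, rfl⟩
    obtain ⟨_, ⟨l, rfl⟩, _, ⟨m, rfl⟩, rfl⟩ := Submodule.mem_sup.1 (h1 hp)
    obtain ⟨_, ⟨l', rfl⟩, _, ⟨m', rfl⟩, rfl⟩ := Submodule.mem_sup.1 (h1 hq)
    exact ⟨⁅m, m'⁆, by simp [evenIncl_apply, oddIncl_apply, mk_add, mk_mul]⟩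
  have h3 : derivedPower N 3 = ⊥ := by
    refine Submodule.span_eq_bot.2 ?_
    rintro _ ⟨p, hp, q, hq, rfl⟩
    obtain ⟨l, rfl⟩ := h2 hp
    obtain ⟨l', rfl⟩ := h2 hq
    simp [evenIncl_apply, mk_mul, zero_eq_mk]
  have hbar : mk 0 1 0 0 ∈ N := (mem_positivePart hb).2 ⟨1, 0, 0, rfl⟩
  have hodd : ∀ l, mk 0 0 0 l ∈ derivedPower N 1 := fun l =>
    Submodule.subset_span ⟨mk 0 1 0 0, hbar, mk 0 0 l 0, (mem_positivePart hb).2 ⟨0, l, 0, rfl⟩,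
      by simp [mk_mul]⟩
  have hmem : mk 0 0 ⁅b x, b y⁆ 0 ∈ derivedPower N 2 :=
    Submodule.subset_span ⟨_, hodd (b x), _, hodd (b y), by simp [mk_mul]⟩
  have hne : derivedPower N 2 ≠ ⊥ := by
    intro h
    rw [h, Submodule.mem_bot, zero_eq_mk, mk_inj] at hmem
    exact hxy hmem.2.2.1
  have hstep : ∀ k, derivedPower N k = ⊥ → derivedPower N (k + 1) = ⊥ := by
    intro k hk
    refine Submodule.span_eq_bot.2 ?_
    rintro _ ⟨p, hp, q, -, rfl⟩
    rw [hk, Submodule.mem_bot] at hp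
    rw [hp, zero_mul]
  refine ⟨h3, fun k hk h => hne ?_⟩
  interval_cases k
  · exact hstep 1 (hstep 0 h)
  · exact hstep 1 h
  · exact h

end Graded

end JordanDouble

/-! ### Counting basis vectors by degree -/

namespace JordanDouble

open Filter

section Counting

variable {ι : Type v} {s : ι → ℕ}

/-- A box in `(j, a)` for each of the two copies of `E`, plus `1`, `1̄`, `x`, `x̄`; overcounting
costs only a constant factor. -/
lemma deg_le_subset (n : ℕ) :
    {t | deg (ShiftLie.height s) t ≤ n} ⊆
      ({Sum.inl (), Sum.inr (Sum.inl ()), Sum.inr (Sum.inr (Sum.inl (Sum.inl ()))),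
        Sum.inr (Sum.inr (Sum.inr (Sum.inl ())))} : Set _) ∪
      ((fun p => Sum.inr (Sum.inr (Sum.inl (Sum.inr p)))) ''
        (Set.Iic n ×ˢ {a : Finset ι | weight s a ≤ n}) ∪
      (fun p => Sum.inr (Sum.inr (Sum.inr (Sum.inr p)))) ''
        (Set.Iic n ×ˢ {a : Finset ι | weight s a ≤ n})) := by
  rintro (t | t | (t | ⟨j, a⟩) | (t | ⟨j, a⟩)) h
  · exact Or.inl (by simp)
  · exact Or.inl (by simp)
  · exact Or.inl (by simp)
  · simp only [Set.mem_ofPred_eq, deg, ShiftLie.height] at h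
    exact Or.inr (Or.inl ⟨(j, a), ⟨by simp only [Set.mem_Iic]; omega,
      by simp only [Set.mem_ofPred_eq]; omega⟩, rfl⟩)
  · exact Or.inl (by simp)
  · simp only [Set.mem_ofPred_eq, deg, ShiftLie.height] at h
    exact Or.inr (Or.inr ⟨(j, a), ⟨by simp only [Set.mem_Iic]; omega,
      by simp only [Set.mem_ofPred_eq]; omega⟩, rfl⟩)

lemma ncard_Iic_prod (n : ℕ) (A : Set (Finset ι)) :
    (Set.Iic n ×ˢ A).ncard = (n + 1) * A.ncard := by
  rw [Set.ncard_prod, ← Finset.coe_Iic, Set.ncard_coe_finset, Nat.card_Iic]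

variable (hfin : ∀ n, {a : Finset ι | weight s a ≤ n}.Finite)

include hfin in
lemma deg_le_finite (n : ℕ) : {t | deg (ShiftLie.height s) t ≤ n}.Finite := by
  have h := (Set.finite_Iic n).prod (hfin n)
  exact ((Set.toFinite _).union ((h.image _).union (h.image _))).subset (deg_le_subset n)

include hfin in
lemma ncard_deg_le (n : ℕ) :
    {t | deg (ShiftLie.height s) t ≤ n}.ncard ≤
      4 + 2 * ((n + 1) * {a : Finset ι | weight s a ≤ n}.ncard) := by
  have h := (Set.finite_Iic n).prod (hfin n)
  refine (Set.ncard_le_ncard (deg_le_subset n)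
    ((Set.toFinite _).union ((h.image _).union (h.image _)))).trans ?_
  refine (Set.ncard_union_le _ _).trans (add_le_add ?_ ?_)
  · iterate 3 refine (Set.ncard_insert_le _ _).trans (Nat.succ_le_succ ?_)
    rw [Set.ncard_singleton]
  · refine (Set.ncard_union_le _ _).trans ?_
    rw [two_mul, ← ncard_Iic_prod]
    exact add_le_add (Set.ncard_image_le h) (Set.ncard_image_le h)

include hfin in
-- If `j` and the weight of `a` are both at most `m`, the even vector `D ^ j a` has degree at most
-- `3 · 2m + 1`.
lemma le_ncard_deg_le {m n : ℕ} (h : 6 * m + 1 ≤ n) :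
    (m + 1) * {a : Finset ι | weight s a ≤ m}.ncard ≤
      {t | deg (ShiftLie.height s) t ≤ n}.ncard := by
  rw [← ncard_Iic_prod]
  refine Set.ncard_le_ncard_of_injOn (fun p => Sum.inr (Sum.inr (Sum.inl (Sum.inr p)))) ?_ ?_
    (deg_le_finite hfin n)
  · rintro ⟨j, a⟩ ⟨hj, ha⟩
    simp only [Set.mem_Iic, Set.mem_ofPred_eq] at hj ha
    simp only [Set.mem_ofPred_eq, deg, ShiftLie.height]
    omega
  · intro p _ q _ hpq
    simpa using hpq

include hfin in
lemma ncard_deg_le_bounds {α c C : ℝ} (hα : 0 ≤ α) (hc : 0 < c)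
    (h : ∀ n : ℕ, 1 ≤ n → c * (n : ℝ) ^ α ≤ {a : Finset ι | weight s a ≤ n}.ncard ∧
      ({a : Finset ι | weight s a ≤ n}.ncard : ℝ) ≤ C * (n : ℝ) ^ α) :
    ∀ᶠ n : ℕ in atTop,
      (c * (16⁻¹ : ℝ) ^ (α + 1)) * (n : ℝ) ^ (α + 1) ≤
        {t | deg (ShiftLie.height s) t ≤ n}.ncard ∧
      ({t | deg (ShiftLie.height s) t ≤ n}.ncard : ℝ) ≤ (4 + 4 * C) * (n : ℝ) ^ (α + 1) := by
  filter_upwards [eventually_ge_atTop 8] with n hn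
  constructor
  -- For `n ≥ 8` this gives both `6 m + 1 ≤ n` and `n ≤ 16 m`, the source of `16⁻¹`.
  · set m := n / 8 with hm
    have hm1 : 1 ≤ m := by omega
    have h1 := le_ncard_deg_le hfin (m := m) (n := n) (by omega)
    have h1' : ((m : ℝ) + 1) * {a : Finset ι | weight s a ≤ m}.ncard ≤
      {t | deg (ShiftLie.height s) t ≤ n}.ncard := by exact_mod_cast h1
    refine le_trans ?_ h1'
    have h2 := (h m hm1).1
    have hm0 : (0 : ℝ) < m := by exact_mod_cast hm1
    rw [mul_assoc, ← Real.mul_rpow (by positivity) (by positivity)]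
    have h3 : (16⁻¹ : ℝ) * n ≤ m := by
      rw [inv_mul_le_iff₀ (by norm_num)]
      exact_mod_cast (by omega : n ≤ 16 * m)
    have h4 : ((16⁻¹ : ℝ) * n) ^ (α + 1) ≤ (m : ℝ) ^ (α + 1) :=
      Real.rpow_le_rpow (by positivity) h3 (by positivity)
    calc c * ((16⁻¹ : ℝ) * n) ^ (α + 1) ≤ c * (m : ℝ) ^ (α + 1) := by gcongr
      _ = m * (c * (m : ℝ) ^ α) := by rw [Real.rpow_add_one hm0.ne']; ring
      _ ≤ (m + 1) * (c * (m : ℝ) ^ α) := by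
          have : 0 ≤ c * (m : ℝ) ^ α := by positivity
          nlinarith
      _ ≤ _ := by gcongr
  · have h1 : ({t | deg (ShiftLie.height s) t ≤ n}.ncard : ℝ) ≤
        4 + 2 * ((n + 1) * {a : Finset ι | weight s a ≤ n}.ncard) := by
      exact_mod_cast ncard_deg_le hfin n
    have h2 := (h n (by omega)).2
    have hn1 : (1 : ℝ) ≤ n := by exact_mod_cast (by omega : 1 ≤ n)
    have hn0 : (0 : ℝ) < n := by linarith
    have h3 : (1 : ℝ) ≤ (n : ℝ) ^ (α + 1) := Real.one_le_rpow hn1 (by linarith)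
    calc ({t | deg (ShiftLie.height s) t ≤ n}.ncard : ℝ)
        ≤ 4 + 2 * ((n + 1) * {a : Finset ι | weight s a ≤ n}.ncard) := h1
      _ ≤ 4 + 2 * ((n + n) * (C * (n : ℝ) ^ α)) := by gcongr
      _ = 4 * 1 + 4 * C * (n : ℝ) ^ (α + 1) := by rw [Real.rpow_add_one hn0.ne']; ring
      _ ≤ 4 * (n : ℝ) ^ (α + 1) + 4 * C * (n : ℝ) ^ (α + 1) := by gcongr
      _ = _ := by ring

end Counting

end JordanDouble

/-! ### Assembling the example -/

open JordanDouble in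
theorem theorem3p4 (K : Type u) [Field K] (hK : ringChar K ≠ 2) (r : ℝ) (hr : 1 ≤ r) :
    ∃ (J : Type u) (_ : NonAssocRing J) (_ : Module K J)
      (_ : IsScalarTower K J J) (_ : SMulCommClass K J J)
      (P : ZMod 2 → Submodule K J) (X : Finset J),
      IsJordanSuperalgebra K P ∧
      -- three homogeneous generators
      X.card = 3 ∧ (∀ x ∈ X, ∃ i : ZMod 2, x ∈ P i) ∧ GeneratesAlgebra K (X : Set J) ∧
      -- both Gelfand-Kirillov dimensions equal `r`, whichever finite generating set is used
      (∀ Y : Finset J, GeneratesAlgebra K (Y : Set J) →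
        upperGKDim K (Y : Set J) = (r : EReal) ∧ lowerGKDim K (Y : Set J) = (r : EReal)) ∧
      -- `J` is graded by degree in the generators, with vanishing components `J_{3n}`, `n ≥ 1`
      IsAlgebraGrading K (degreeComponent K (X : Set J)) ∧
      (∀ n : ℕ, 1 ≤ n → degreeComponent K (X : Set J) (3 * n) = ⊥) ∧
      -- the ideal without unit is solvable of length 3
      IsTwoSidedIdealSubmodule (positivePart K (X : Set J)) ∧
      IsCompl (Submodule.span K {(1 : J)}) (positivePart K (X : Set J)) ∧
      IsSolvableOfLength (positivePart K (X : Set J)) 3 := by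
  classical
  have h2 : (2 : K) ≠ 0 := Ring.two_ne_zero hK
  -- Subsets are to grow with exponent `r - 1`; the powers of `D` supply the missing 1.
  have hα : 0 ≤ r - 1 := by linarith
  obtain ⟨ι, s, hinj, hodd, hfin, c, C, hc, hC, hbound⟩ := exists_odd_sequence_growth hα
  have hs : Function.IsPartialInv s (Function.partialInv s) := hinj.isPartialInv
  set e := Function.partialInv s
  have hb := ShiftLie.isHomogeneousLieBasis (K := K) h2 hs hodd
  have hne : ShiftLie.basis (K := K) e (Sum.inl ()) ≠ ShiftLie.basis e (Sum.inr (0, ∅)) :=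
    (ShiftLie.basis e).injective.ne (by simp)
  have hgen := gens_generatesAlgebra hb
  have hfin' : ∀ n, {t | deg (ShiftLie.height s) t ≤ n}.Finite := deg_le_finite hfin
  have hgrowth := ncard_deg_le_bounds hfin hα hc hbound
  rw [sub_add_cancel] at hgrowth
  refine ⟨JordanDouble K (ShiftLie K e), inferInstance, inferInstance, inferInstance,
    inferInstance, parityPart K _, gens K _ _, isJordanSuperalgebra, gens_card hne,
    fun _ hp => gens_homogeneous hp, hgen, fun Y hY => ?_, degreeComponent_isAlgebraGrading hb,
    fun n hn => degreeComponent_three_mul hb hn, positivePart_isTwoSidedIdeal hb,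
    isCompl_positivePart hb, positivePart_isSolvableOfLength hb ShiftLie.lie_basis_ne_zero⟩
  refine gkDim_eq_of_growth_bounds hgen hY (fun n => ?_) (by linarith)
    (c := c * (16⁻¹ : ℝ) ^ r) (C := 4 + 4 * C) (by positivity) (by positivity) ?_
  · rw [lengthFiltration_eq hb]
    exact FiniteDimensional.span_of_finite K ((hfin' n).image _)
  · filter_upwards [hgrowth] with n hn
    rwa [growthFunction, lengthFiltration_eq hb, Module.Basis.finrank_span_image]
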